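/- Let $a<b$ and $k\ge 1$. Let $u$ be a smooth solution (that is, $C^\infty$ on $\mathbb R\times[0,T]$ after $(b-a)$-periodic extension in $x$) of $$u_t=-u_{xxxx},\quad x\in[a,b],\ 0\le t\le T,\qquad u(x,0)=u_0(x),$$ with periodic boundary conditions on $[a,b]$. Partition $[a,b]$ into $N\ge 1$ cells $I_j=[x_{j-1/2},x_{j+1/2}]$, $x_{1/2}=a<x_{3/2}<\dots<x_{N+1/2}=b$, with $h=\max_j(x_{j+1/2}-x_{j-1/2})$; if $k=1$, assume that all cells have the same length. Let $V_h^k$ be the space of functions that are polynomials of degree at most $k$ on each cell. At interfaces let $v^{\pm}$ be the one-sided traces, $\{v\}=\frac12(v^-+v^+)$ and $[v]=v^+-v^-$, where at $x_{N+1/2}=b$ the trace $v^+$ is the trace of $v$ at $a$ from the first cell. Put $$A(w,v)=\sum_{j=1}^N\int_{I_j}w_xv_x\,dx+\sum_{j=1}^N\big(\{w_x\}[v]+[w]\{v_x\}\big)_{j+1/2}.$$ Let $\frac12\le\theta\le1$ and $\Delta t>0$, and let $(u_h^n,q_h^n)\in V_h^k\times V_h^k$, $n\ge0$, be the numerical solution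 of the fully discrete DG scheme: $u_h^0$ is the piecewise $L^2$ projection of $u_0$, that is, $\int_{I_j}(u_0-u_h^0)\phi\,dx=0$ for all $j$ and all $\phi\in P^k(I_j)$, and for all $n\ge 0$ and all $\phi,\psi\in V_h^k$ $$\Big(\frac{u_h^{n+1}-u_h^n}{\Delta t},\phi\Big)=-A\big((1-\theta)q_h^n+\theta q_h^{n+1},\phi\big),\qquad (q_h^n,\psi)=A(u_h^n,\psi),$$ where $(\cdot,\cdot)$ is the inner product of $L^2([a,b])$. Then for all $n$ with $t^n=n\Delta t\le T$ $$\|u(\cdot,t^n)-u_h^n\|_{L^2([a,b])}\le C(1+T)\Big(h^{k+1}+\big(\theta-\tfrac12\big)\Delta t+(\Delta t)^2\Big),$$ where $C$ depends only on $a$, $b$, $k$ and on upper bounds for $\sup_{t\in[0,T]}|u_t(\cdot,t)|_{k+1}$, $\sup_{t\in[0,T]}|u(\cdot,t)|_{k+3}$, $\sup_{t\in[0,T]}\|u_{tt}(\cdot,t)\|$ and $\sup_{t\in[0,T]}\|u_{ttt}(\cdot,t)\|$; here $|v|_m=\|\partial_x^m v\|_{L^2([a,b])}$. In particular $C$ is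 independent of the mesh, $h$, $\theta$, $\Delta t$, $n$ and $T$. -/

import Mathlib

open Set Polynomial
open scoped ContDiff

noncomputable section

/-- A partition `a = x_{1/2} < x_{3/2} < ⋯ < x_{N+1/2} = b` of `[a, b]` into `N` cells.
`node i` is `x_{i+1/2}` for `i = 0, …, N`; the cell `I_{j+1}` is `[node j.castSucc, node j.succ]`
for `j : Fin N`. -/
structure DGMesh (a b : ℝ) (N : ℕ) where
  node : Fin (N + 1) → ℝ
  strictMono : StrictMono node
  node_zero : node 0 = a
  node_last : node (Fin.last N) = b

namespace DGMesh

variable {a b : ℝ} {N : ℕ}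

/-- Left end point of a cell. -/
def left (M : DGMesh a b N) (j : Fin N) : ℝ := M.node j.castSucc

/-- Right end point of a cell. -/
def right (M : DGMesh a b N) (j : Fin N) : ℝ := M.node j.succ

/-- The length of a cell. -/
def cellSize (M : DGMesh a b N) (j : Fin N) : ℝ := M.right j - M.left j

/-- The mesh size `h`, the largest cell length. -/
def h (M : DGMesh a b N) : ℝ := ⨆ j, M.cellSize j

/-- All cells have the same length. -/
def IsUniform (M : DGMesh a b N) : Prop := ∀ i j, M.cellSize i = M.cellSize j

end DGMesh

/-- The space `V_h^k` of piecewise polynomials of degree at most `k` on `N` cells: an element is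
given by its polynomial on each cell. -/
abbrev DGSpace (N k : ℕ) : Type := Fin N → Polynomial.degreeLE ℝ (k : WithBot ℕ)

namespace DGMesh

variable {a b : ℝ} {N : ℕ} {k : ℕ}

/-- The inner product `(w, v)` of `L²([a, b])` on `V_h^k`. -/
def inner (M : DGMesh a b N) (w v : DGSpace N k) : ℝ :=
  ∑ j, ∫ x in (M.left j)..(M.right j), ((w j : ℝ[X]).eval x * (v j : ℝ[X]).eval x)

/-- The norm `‖f - v‖` of `L²([a, b])`, for a function `f` and an element `v` of `V_h^k`. -/
def l2Dist (M : DGMesh a b N) (f : ℝ → ℝ) (v : DGSpace N k) : ℝ :=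
  √(∑ j, ∫ x in (M.left j)..(M.right j), (f x - (v j : ℝ[X]).eval x) ^ 2)

/-- The trace `v⁻` at the right end point of cell `j`, from inside that cell, for a piecewise
polynomial `v`. -/
def traceMinus (M : DGMesh a b N) (v : Fin N → ℝ[X]) (j : Fin N) : ℝ :=
  (v j).eval (M.right j)

/-- The trace `v⁺` at the right end point of cell `j`, from the next cell. The index `j + 1` is
cyclic in `Fin N`: at `b` it is the trace at `a` from the first cell (periodicity). -/
def tracePlus [NeZero N] (M : DGMesh a b N) (v : Fin N → ℝ[X]) (j : Fin N) : ℝ :=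
  (v (j + 1)).eval (M.left (j + 1))

/-- The average `{v} = (v⁻ + v⁺) / 2` at the right end point of cell `j`. -/
def avg [NeZero N] (M : DGMesh a b N) (v : Fin N → ℝ[X]) (j : Fin N) : ℝ :=
  (M.traceMinus v j + M.tracePlus v j) / 2

/-- The jump `[v] = v⁺ - v⁻` at the right end point of cell `j`. -/
def jump [NeZero N] (M : DGMesh a b N) (v : Fin N → ℝ[X]) (j : Fin N) : ℝ :=
  M.tracePlus v j - M.traceMinus v j

/-- The penalty-free DG bilinear form
`A(w, v) = ∑_j ∫_{I_j} w_x v_x dx + ∑_j ({w_x} [v] + [w] {v_x})_{j+1/2}`. -/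
def A [NeZero N] (M : DGMesh a b N) (w v : DGSpace N k) : ℝ :=
  (∑ j, ∫ x in (M.left j)..(M.right j),
      ((derivative (w j : ℝ[X])).eval x * (derivative (v j : ℝ[X])).eval x))
    + ∑ j, (M.avg (fun i => derivative (w i : ℝ[X])) j * M.jump (fun i => (v i : ℝ[X])) j
        + M.jump (fun i => (w i : ℝ[X])) j * M.avg (fun i => derivative (v i : ℝ[X])) j)

/-- `v` is the piecewise `L²` projection of `u₀` onto `V_h^k`. -/
def IsL2Projection (M : DGMesh a b N) (u₀ : ℝ → ℝ) (v : DGSpace N k) : Prop :=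
  ∀ (j : Fin N) (φ : Polynomial.degreeLE ℝ (k : WithBot ℕ)),
    (∫ x in (M.left j)..(M.right j), (u₀ x - (v j : ℝ[X]).eval x) * (φ : ℝ[X]).eval x) = 0

/-- `(uh n, qh n)`, `n = 0, 1, 2, …`, is the numerical solution of the fully discrete DG scheme
with parameter `θ`, time step `Δt` and initial data `u₀`. -/
structure IsThetaSolution [NeZero N] (M : DGMesh a b N) (θ Δt : ℝ) (u₀ : ℝ → ℝ)
    (uh qh : ℕ → DGSpace N k) : Prop where
  initial : M.IsL2Projection u₀ (uh 0)
  step : ∀ (n : ℕ) (φ : DGSpace N k),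
    M.inner (Δt⁻¹ • (uh (n + 1) - uh n)) φ = -M.A ((1 - θ) • qh n + θ • qh (n + 1)) φ
  aux : ∀ (n : ℕ) (ψ : DGSpace N k), M.inner (qh n) ψ = M.A (uh n) ψ

end DGMesh

/-- The norm `‖v‖` of `L²([a, b])`, used for continuous functions. -/
def l2Norm (a b : ℝ) (v : ℝ → ℝ) : ℝ := √(∫ x in a..b, v x ^ 2)

/-- The `i`-th time derivative of `u`, a function of `(x, t)` with `t ∈ [0, T]` (one-sided at the
two ends). -/
def timeDeriv (T : ℝ) (i : ℕ) (u : ℝ → ℝ → ℝ) (x t : ℝ) : ℝ :=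
  iteratedDerivWithin i (fun s => u x s) (Icc 0 T) t

/-- `u`, a function of `(x, t)`, is a smooth solution on the time interval `[0, T]` of
`u_t = -u_{xxxx}` with periodic boundary conditions on `[a, b]` and initial data `u₀`. The function
is extended periodically to all `x`, and smoothness is up to `t = 0` and `t = T`. -/
structure IsSmoothSolution (a b T : ℝ) (u₀ : ℝ → ℝ) (u : ℝ → ℝ → ℝ) : Prop where
  smooth : ContDiffOn ℝ ∞ (fun p : ℝ × ℝ => u p.1 p.2) (univ ×ˢ Icc 0 T)
  periodic : ∀ t ∈ Icc 0 T, ∀ x, u (x + (b - a)) t = u x t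
  eqn : ∀ t ∈ Icc 0 T, ∀ x, timeDeriv T 1 u x t = -iteratedDeriv 4 (fun y => u y t) x
  initial : ∀ x, u x 0 = u₀ x

end

/-! ### Integral inequalities on an interval -/

/-! Put q = -u_xx, so that u_t = q_xx. The form A is a discrete version of w ↦ -w_xx that is
symmetric but carries no penalty, and no coercivity of A is used. Stability comes from symmetry
alone. Subtract the scheme from its consistency relations for approximations χ of u and ζ of q. Test
the evolution equation with the θ-average of χ - u_h and the auxiliary equation with the θ-average
of ζ - q_h. The two A-terms are then equal and cancel, and the square of the error in q remains with
a good sign and absorbs its own consistency error (`energy_step`, `DGMesh.sq_norm_theta_step_le`).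
The condition θ ≥ 1/2 makes the time-difference term nonnegative. Summation over the steps gives
growth linear in time, with no restriction on the time step (`le_of_energy_growth`).

What remains is to find χ with ‖w - χ‖ and the defect A(χ, v) + (w_xx, v) both of order h^{k+1}
(`DGMesh.exists_approximation`). Integrating by parts twice shows that the defect involves only
moments of χ - w against v_xx and the interface averages of χ - w and its derivative
(`DGMesh.A_add_integral`).

For k ≥ 2 there are enough degrees of freedom to make all of these vanish. The resulting elliptic
projection is globally coupled, and its accuracy comes from an energy identity, valid on arbitrary
meshes (`DGMesh.exists_l2Dist_ellipticProjection_le`). The same estimate with w = 0 gives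
uniqueness, hence existence.

For k = 1 the cell moments are missing. On a uniform mesh an explicit quasi-interpolant has
interface errors of order h² only, but they vary slowly from one interface to the next. After
regrouping by cells only combinations that annihilate cubics survive, and the defect is again of
order h² (`DGMesh.abs_A_quasiInterpolant_add_integral_le`).

Both constructions respect differences, so the approximation error of a time increment gains a
factor Δt. The time-stepping defect is the trapezoidal error plus (θ - 1/2) times a
second-derivative term (`SmoothInTime.l2Norm_theta_defect_le`). -/

theorem sq_integral_mul_le {l r : ℝ} (hlr : l ≤ r) {f g : ℝ → ℝ} (hf : Continuous f)
    (hg : Continuous g) :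
    (∫ x in l..r, f x * g x) ^ 2 ≤ (∫ x in l..r, f x ^ 2) * ∫ x in l..r, g x ^ 2 := by
  have key : ∀ t : ℝ, 0 ≤ (∫ x in l..r, g x ^ 2) * (t * t) + (2 * ∫ x in l..r, f x * g x) * t
      + ∫ x in l..r, f x ^ 2 := by
    intro t
    have h : ∫ x in l..r, (f x + t * g x) ^ 2 = (∫ x in l..r, g x ^ 2) * (t * t)
        + (2 * ∫ x in l..r, f x * g x) * t + ∫ x in l..r, f x ^ 2 := by
      have : ∀ x, (f x + t * g x) ^ 2 = (t * t) * g x ^ 2 + (2 * t) * (f x * g x) + f x ^ 2 := by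
        intro x; ring
      simp_rw [this]
      rw [intervalIntegral.integral_add, intervalIntegral.integral_add,
        intervalIntegral.integral_const_mul, intervalIntegral.integral_const_mul]
      · ring
      all_goals exact Continuous.intervalIntegrable (by fun_prop) _ _
    rw [← h]
    exact intervalIntegral.integral_nonneg hlr fun x _ => sq_nonneg _
  have := discrim_le_zero key
  rw [discrim] at this
  nlinarith

theorem l2Norm_nonneg (l r : ℝ) (f : ℝ → ℝ) : 0 ≤ l2Norm l r f := Real.sqrt_nonneg _

theorem sq_l2Norm {l r : ℝ} (hlr : l ≤ r) (f : ℝ → ℝ) :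
    l2Norm l r f ^ 2 = ∫ x in l..r, f x ^ 2 :=
  Real.sq_sqrt (intervalIntegral.integral_nonneg hlr fun _ _ => sq_nonneg _)

theorem abs_integral_mul_le_l2Norm {l r : ℝ} (hlr : l ≤ r) {f g : ℝ → ℝ} (hf : Continuous f)
    (hg : Continuous g) :
    |∫ x in l..r, f x * g x| ≤ l2Norm l r f * l2Norm l r g := by
  refine abs_le_of_sq_le_sq ?_ (mul_nonneg (l2Norm_nonneg _ _ _) (l2Norm_nonneg _ _ _))
  rw [mul_pow, sq_l2Norm hlr, sq_l2Norm hlr]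
  exact sq_integral_mul_le hlr hf hg

theorem abs_integral_le_l2Norm {l r c x : ℝ} {f : ℝ → ℝ} (hf : Continuous f) (hc : c ∈ Icc l r)
    (hx : x ∈ Icc l r) : |∫ y in c..x, f y| ≤ √(r - l) * l2Norm l r f := by
  have hlr : l ≤ r := hc.1.trans hc.2
  have h1 : |∫ y in c..x, f y| ≤ |(∫ y in c..x, |f y|)| :=
    intervalIntegral.norm_integral_le_abs_integral_norm (f := f) (μ := MeasureTheory.volume)
  have hsub : uIoc c x ⊆ uIoc l r := by
    rw [uIoc_of_le hlr]
    exact Ioc_subset_Ioc (le_min hc.1 hx.1) (max_le hc.2 hx.2)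
  have h2 : |(∫ y in c..x, |f y|)| ≤ |(∫ y in l..r, |f y|)| :=
    intervalIntegral.abs_integral_mono_interval hsub
      (Filter.Eventually.of_forall fun y => abs_nonneg _) (hf.abs.intervalIntegrable _ _)
  have h3 := abs_integral_mul_le_l2Norm hlr (f := fun _ => (1 : ℝ)) continuous_const hf.abs
  have h4 : l2Norm l r (fun _ => (1 : ℝ)) = √(r - l) := by simp [l2Norm]
  have h5 : l2Norm l r (fun y => |f y|) = l2Norm l r f := by simp [l2Norm]
  simp only [one_mul] at h3
  rw [h4, h5] at h3
  linarith

theorem abs_integral_le_of_abs_le {l r c x K : ℝ} {f : ℝ → ℝ} (hK : ∀ y ∈ Icc l r, |f y| ≤ K)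
    (hc : c ∈ Icc l r) (hx : x ∈ Icc l r) : |∫ y in c..x, f y| ≤ (r - l) * K := by
  have hK0 : 0 ≤ K := (abs_nonneg _).trans (hK c hc)
  have h := intervalIntegral.norm_integral_le_of_norm_le_const (a := c) (b := x) (f := f) (C := K)
    (fun y hy => hK y ⟨(le_min hc.1 hx.1).trans hy.1.le, hy.2.trans (max_le hc.2 hx.2)⟩)
  rw [Real.norm_eq_abs] at h
  refine h.trans ?_
  rw [mul_comm]
  refine mul_le_mul_of_nonneg_right (abs_le.2 ⟨?_, ?_⟩) hK0 <;> linarith [hc.1, hc.2, hx.1, hx.2]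

theorem l2Norm_le_of_abs_le {l r K : ℝ} (hlr : l ≤ r) {f : ℝ → ℝ} (hf : Continuous f)
    (hK0 : 0 ≤ K) (hK : ∀ y ∈ Icc l r, |f y| ≤ K) : l2Norm l r f ≤ √(r - l) * K := by
  refine Real.sqrt_le_iff.2 ⟨by positivity, ?_⟩
  rw [mul_pow, Real.sq_sqrt (by linarith)]
  have := intervalIntegral.integral_mono_on hlr (f := fun x => f x ^ 2) (g := fun _ => K ^ 2)
    (μ := MeasureTheory.volume) ((hf.pow 2).intervalIntegrable _ _) (by simp)
    (fun x hx => sq_le_sq' (by linarith [(abs_le.1 (hK x hx)).1]) (abs_le.1 (hK x hx)).2)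
  simpa using this

theorem eq_zero_of_l2Norm_eq_zero {l r : ℝ} (hlr : l < r) {f : ℝ → ℝ} (hf : Continuous f)
    (h : l2Norm l r f = 0) : ∀ x ∈ Icc l r, f x = 0 := by
  have h0 : ∫ x in l..r, f x ^ 2 = 0 := by rw [← sq_l2Norm hlr.le, h]; ring
  intro x hx
  by_contra hne
  have := intervalIntegral.integral_pos hlr (f := fun x => f x ^ 2) (by fun_prop)
    (fun y _ => sq_nonneg _) ⟨x, hx, by positivity⟩
  linarith

theorem deriv_contDiff {w : ℝ → ℝ} (hw : ContDiff ℝ ∞ w) : ContDiff ℝ ∞ (deriv w) :=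
  (contDiff_infty_iff_deriv.1 hw).2

theorem hasDerivAt_of_contDiff {w : ℝ → ℝ} (hw : ContDiff ℝ ∞ w) (x : ℝ) :
    HasDerivAt w (deriv w x) x :=
  ((contDiff_infty_iff_deriv.1 hw).1 x).hasDerivAt

theorem iteratedDeriv_contDiff {w : ℝ → ℝ} (hw : ContDiff ℝ ∞ w) (m : ℕ) :
    ContDiff ℝ ∞ (iteratedDeriv m w) := by
  induction m with
  | zero => simpa using hw
  | succ m ih => rw [iteratedDeriv_succ]; exact deriv_contDiff ih

theorem integral_deriv_of_contDiff {w : ℝ → ℝ} (hw : ContDiff ℝ ∞ w) (c x : ℝ) :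
    ∫ y in c..x, deriv w y = w x - w c :=
  intervalIntegral.integral_eq_sub_of_hasDerivAt (fun y _ => hasDerivAt_of_contDiff hw y)
    ((deriv_contDiff hw).continuous.intervalIntegrable _ _)

/-! ### Taylor polynomials -/

/-- The Taylor polynomial of degree `m` of `w` at `c`. -/
noncomputable def taylorPoly (m : ℕ) (w : ℝ → ℝ) (c : ℝ) : ℝ[X] :=
  ∑ i ∈ Finset.range (m + 1), C (iteratedDeriv i w c / i.factorial) * (X - C c) ^ i

theorem taylorPoly_eval_self (m : ℕ) (w : ℝ → ℝ) (c : ℝ) : (taylorPoly m w c).eval c = w c := by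
  simp [taylorPoly, Finset.sum_range_succ', eval_finsetSum]

theorem derivative_taylorPoly (m : ℕ) (w : ℝ → ℝ) (c : ℝ) :
    derivative (taylorPoly (m + 1) w c) = taylorPoly m (deriv w) c := by
  rw [taylorPoly, Finset.sum_range_succ', derivative_add, derivative_sum]
  simp only [taylorPoly, pow_zero, mul_one, derivative_C, add_zero]
  refine Finset.sum_congr rfl fun i _ => ?_
  rw [derivative_C_mul, derivative_X_sub_C_pow, iteratedDeriv_succ', add_tsub_cancel_right,
    ← mul_assoc, ← C_mul]
  congr 2
  rw [Nat.factorial_succ]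
  have h1 : ((i.factorial : ℕ) : ℝ) ≠ 0 := by positivity
  have h2 : ((i + 1 : ℕ) : ℝ) ≠ 0 := by positivity
  push_cast at h2 ⊢
  field_simp

theorem degree_taylorPoly_le (m : ℕ) (w : ℝ → ℝ) (c : ℝ) : (taylorPoly m w c).degree ≤ m := by
  refine (degree_sum_le _ _).trans (Finset.sup_le fun i hi => ?_)
  rw [← smul_eq_C_mul]
  refine (degree_smul_le _ _).trans ?_
  rw [degree_pow, degree_X_sub_C, nsmul_eq_mul, mul_one]
  exact_mod_cast Nat.lt_succ_iff.1 (Finset.mem_range.1 hi)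

/-- Induction on the degree: the derivative of the remainder is the remainder of the derivative, and
integrating its uniform bound from c costs one factor of the interval length. Cauchy–Schwarz at the
bottom level supplies the square root and the `L²` norm. -/
theorem abs_sub_taylorPoly_le {l r c : ℝ} (hc : c ∈ Icc l r) (m : ℕ) :
    ∀ {w : ℝ → ℝ}, ContDiff ℝ ∞ w → ∀ x ∈ Icc l r,
      |w x - (taylorPoly m w c).eval x| ≤
        (r - l) ^ m * √(r - l) * l2Norm l r (iteratedDeriv (m + 1) w) := by
  induction m with
  | zero =>
    intro w hw x hx
    have h := abs_integral_le_l2Norm (deriv_contDiff hw).continuous hc hx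
    rw [integral_deriv_of_contDiff hw] at h
    simpa [taylorPoly, iteratedDeriv_one] using h
  | succ m ih =>
    intro w hw x hx
    have hp : ∀ y, HasDerivAt (fun y => w y - (taylorPoly (m + 1) w c).eval y)
        (deriv w y - (taylorPoly m (deriv w) c).eval y) y := by
      intro y
      rw [← derivative_taylorPoly]
      exact (hasDerivAt_of_contDiff hw y).sub (Polynomial.hasDerivAt _ _)
    have hcont : Continuous fun y => deriv w y - (taylorPoly m (deriv w) c).eval y :=
      (deriv_contDiff hw).continuous.sub (Polynomial.continuous _)
    have h1 := intervalIntegral.integral_eq_sub_of_hasDerivAt (a := c) (b := x) (fun y _ => hp y)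
      (hcont.intervalIntegrable _ _)
    rw [taylorPoly_eval_self, sub_self, sub_zero] at h1
    rw [← h1]
    refine (abs_integral_le_of_abs_le (ih (deriv_contDiff hw)) hc hx).trans (le_of_eq ?_)
    rw [← iteratedDeriv_succ']
    ring

theorem abs_deriv_sub_taylorPoly_le {l r c : ℝ} (hc : c ∈ Icc l r) (m : ℕ) {w : ℝ → ℝ}
    (hw : ContDiff ℝ ∞ w) (x : ℝ) (hx : x ∈ Icc l r) :
    |deriv w x - (derivative (taylorPoly (m + 1) w c)).eval x| ≤
      (r - l) ^ m * √(r - l) * l2Norm l r (iteratedDeriv (m + 2) w) := by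
  rw [derivative_taylorPoly, iteratedDeriv_succ']
  exact abs_sub_taylorPoly_le hc m (deriv_contDiff hw) x hx

/-! ### A Poincaré inequality for derivatives of periodic functions -/

theorem periodic_deriv {c : ℝ} {w : ℝ → ℝ} (h : Function.Periodic w c) :
    Function.Periodic (deriv w) c := by
  intro x
  rw [← deriv_comp_add_const, show (fun y => w (y + c)) = w from funext h]

theorem periodic_iteratedDeriv {c : ℝ} {w : ℝ → ℝ} (h : Function.Periodic w c) (m : ℕ) :
    Function.Periodic (iteratedDeriv m w) c := by
  induction m with
  | zero => simpa using h
  | succ m ih => rw [iteratedDeriv_succ]; exact periodic_deriv ih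

/-- By Rolle and periodicity the derivative of order m + 1 has a zero in the period, so it is
bounded by the integral of the next one. Applied twice, this removes the seminorm of order k + 1 of
u from the final constant in favour of order k + 3. -/
theorem l2Norm_iteratedDeriv_le_succ {a b : ℝ} (hab : a < b) {w : ℝ → ℝ} (hw : ContDiff ℝ ∞ w)
    (hp : Function.Periodic w (b - a)) (m : ℕ) :
    l2Norm a b (iteratedDeriv (m + 1) w) ≤ (b - a) * l2Norm a b (iteratedDeriv (m + 2) w) := by
  set f := iteratedDeriv m w with hf
  have hfs : ContDiff ℝ ∞ f := iteratedDeriv_contDiff hw m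
  have hfp : f a = f b := by
    have := periodic_iteratedDeriv hp m a
    rw [hf, ← this]; congr 1; ring
  obtain ⟨c, hc, hc0⟩ := exists_deriv_eq_zero hab hfs.continuous.continuousOn hfp
  have hg : iteratedDeriv (m + 1) w = deriv f := iteratedDeriv_succ
  have hg2 : iteratedDeriv (m + 2) w = deriv (deriv f) := by rw [iteratedDeriv_succ, hg]
  rw [hg, hg2]
  have hs := deriv_contDiff hfs
  have := l2Norm_le_of_abs_le hab.le hs.continuous
    (K := √(b - a) * l2Norm a b (deriv (deriv f)))
    (mul_nonneg (Real.sqrt_nonneg _) (l2Norm_nonneg _ _ _)) (fun x hx => by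
      have := abs_integral_le_l2Norm (deriv_contDiff hs).continuous ⟨hc.1.le, hc.2.le⟩ hx
      rwa [integral_deriv_of_contDiff hs, hc0, sub_zero] at this)
  rwa [← mul_assoc, Real.mul_self_sqrt (by linarith)] at this

/-! ### An inverse inequality -/

/-- The inner product of `L²([0, 1])` on polynomials of degree at most `k`. -/
noncomputable abbrev unitIntervalCore (k : ℕ) :
    InnerProductSpace.Core ℝ (Polynomial.degreeLE ℝ (k : WithBot ℕ)) where
  inner p q := ∫ x in (0 : ℝ)..1, (p : ℝ[X]).eval x * (q : ℝ[X]).eval x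
  conj_inner_symm p q := by simp [mul_comm]
  re_inner_nonneg p :=
    intervalIntegral.integral_nonneg zero_le_one fun x _ => mul_self_nonneg _
  add_left p q s := by
    simp only [Submodule.coe_add, eval_add, add_mul]
    exact intervalIntegral.integral_add (Continuous.intervalIntegrable (by fun_prop) _ _)
      (Continuous.intervalIntegrable (by fun_prop) _ _)
  smul_left p q c := by
    simp [mul_assoc]
  definite p hp := by
    have h0 : l2Norm 0 1 (fun x => (p : ℝ[X]).eval x) = 0 := by
      rw [l2Norm, Real.sqrt_eq_zero']
      simp only [pow_two]
      exact hp.le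
    have := eq_zero_of_l2Norm_eq_zero zero_lt_one (by fun_prop) h0
    refine Subtype.ext (Polynomial.eq_zero_of_infinite_isRoot _ ?_)
    exact (Icc_infinite (zero_lt_one (α := ℝ))).mono fun x hx => this x hx

instance (k : ℕ) : FiniteDimensional ℝ (Polynomial.degreeLE ℝ (k : WithBot ℕ)) := by
  rw [← degreeLT_succ_eq_degreeLE]
  infer_instance

/-- Differentiation is a linear map of a finite-dimensional space, hence bounded for the norm of
`L²([0, 1])`. -/
theorem exists_l2Norm_derivative_le_unitInterval (k : ℕ) :
    ∃ K : ℝ, 0 ≤ K ∧ ∀ p : ℝ[X], p.degree ≤ k →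
      l2Norm 0 1 (fun x => (derivative p).eval x) ≤ K * l2Norm 0 1 (fun x => p.eval x) := by
  let _ : NormedAddCommGroup (Polynomial.degreeLE ℝ (k : WithBot ℕ)) :=
    (unitIntervalCore k).toNormedAddCommGroup
  let _ : InnerProductSpace ℝ (Polynomial.degreeLE ℝ (k : WithBot ℕ)) :=
    InnerProductSpace.ofCore (unitIntervalCore k).toCore
  have hD : ∀ p ∈ Polynomial.degreeLE ℝ (k : WithBot ℕ),
      derivative p ∈ Polynomial.degreeLE ℝ (k : WithBot ℕ) := fun p hp =>
    mem_degreeLE.2 (degree_derivative_le.trans (mem_degreeLE.1 hp))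
  let D : Polynomial.degreeLE ℝ (k : WithBot ℕ) →ₗ[ℝ] Polynomial.degreeLE ℝ (k : WithBot ℕ) :=
    (derivative (R := ℝ)).restrict hD
  have hn : ∀ p : Polynomial.degreeLE ℝ (k : WithBot ℕ),
      ‖p‖ = l2Norm 0 1 (fun x => (p : ℝ[X]).eval x) := by
    intro p
    simp only [l2Norm, pow_two]
    rfl
  refine ⟨‖D.toContinuousLinearMap‖, ContinuousLinearMap.opNorm_nonneg _, fun p hp => ?_⟩
  have := D.toContinuousLinearMap.le_opNorm ⟨p, mem_degreeLE.2 hp⟩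
  rw [hn, hn] at this
  exact this

theorem exists_l2Norm_derivative_le (k : ℕ) :
    ∃ K : ℝ, 0 ≤ K ∧ ∀ (l r : ℝ), l < r → ∀ p : ℝ[X], p.degree ≤ k →
      (r - l) * l2Norm l r (fun x => (derivative p).eval x) ≤ K * l2Norm l r (fun x => p.eval x) := by
  obtain ⟨K, hK0, hK⟩ := exists_l2Norm_derivative_le_unitInterval k
  refine ⟨K, hK0, fun l r hlr p hp => ?_⟩
  have hh : 0 < r - l := sub_pos.2 hlr
  have scale : ∀ f : ℝ → ℝ, l2Norm l r f = √(r - l) * l2Norm 0 1 (fun y => f ((r - l) * y + l)) := by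
    intro f
    have h := intervalIntegral.mul_integral_comp_mul_add (a := 0) (b := 1)
      (f := fun x => f x ^ 2) (r - l) l
    simp only [mul_zero, zero_add, mul_one, sub_add_cancel] at h
    rw [l2Norm, l2Norm, ← Real.sqrt_mul hh.le, ← h]
  set q : ℝ[X] := p.comp (C (r - l) * X + C l) with hq
  have hqd : q.degree ≤ k := by
    rw [← natDegree_le_iff_degree_le] at hp ⊢
    refine natDegree_comp_le.trans ?_
    have : (C (r - l) * X + C l : ℝ[X]).natDegree ≤ 1 := natDegree_linear_le
    nlinarith
  have h := hK q hqd
  have e1 : (fun x => q.eval x) = fun y => p.eval ((r - l) * y + l) := by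
    ext y; simp [hq]
  have e2 : l2Norm 0 1 (fun x => (derivative q).eval x) =
      (r - l) * l2Norm 0 1 (fun y => (derivative p).eval ((r - l) * y + l)) := by
    have : (fun x => (derivative q).eval x) =
        fun y => (r - l) * (derivative p).eval ((r - l) * y + l) := by
      ext y; simp [hq, derivative_comp]
    rw [this, l2Norm, l2Norm]
    simp_rw [mul_pow]
    rw [intervalIntegral.integral_const_mul, Real.sqrt_mul (by positivity), Real.sqrt_sq hh.le]
  rw [e1, e2] at h
  rw [scale, scale (fun x => p.eval x)]
  have := mul_le_mul_of_nonneg_left h (Real.sqrt_nonneg (r - l))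
  linarith

namespace DGMesh

variable {a b : ℝ} {N k : ℕ}

/-! ### Cells of a mesh -/

theorem left_lt_right (M : DGMesh a b N) (j : Fin N) : M.left j < M.right j :=
  M.strictMono (Fin.castSucc_lt_succ)

theorem left_le_right (M : DGMesh a b N) (j : Fin N) : M.left j ≤ M.right j :=
  (M.left_lt_right j).le

theorem cellSize_pos (M : DGMesh a b N) (j : Fin N) : 0 < M.cellSize j :=
  sub_pos.2 (M.left_lt_right j)

theorem cellSize_le_h (M : DGMesh a b N) (j : Fin N) : M.cellSize j ≤ M.h :=
  le_ciSup (f := M.cellSize) (Set.finite_range _).bddAbove j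

theorem h_nonneg (M : DGMesh a b N) : 0 ≤ M.h :=
  Real.iSup_nonneg fun j => (M.cellSize_pos j).le

theorem sum_integral_cell (M : DGMesh a b N) {f : ℝ → ℝ} (hf : Continuous f) :
    ∑ j, ∫ x in (M.left j)..(M.right j), f x = ∫ x in a..b, f x := by
  -- `Fin.ofNat` wraps around modulo N + 1, but only indices up to N are used.
  let node' : ℕ → ℝ := fun i => M.node (Fin.ofNat (N + 1) i)
  have h := intervalIntegral.sum_integral_adjacent_intervals (a := node') (n := N) (f := f)
    (μ := MeasureTheory.volume) (fun i _ => hf.intervalIntegrable _ _)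
  rw [Finset.sum_range] at h
  have h0 : node' 0 = a := by rw [← M.node_zero]; rfl
  have hN : node' N = b := by
    refine Eq.trans ?_ M.node_last
    simp only [node']; congr 1; ext; simp
  rw [h0, hN] at h
  rw [← h]
  refine Finset.sum_congr rfl fun j _ => ?_
  have hl : node' j = M.left j := by
    simp only [node', left]; congr 1; ext
    simp
  have hr : node' (j + 1) = M.right j := by
    simp only [node', right]; congr 1; ext
    simp
  rw [hl, hr]

theorem sum_sq_l2Norm_cell (M : DGMesh a b N) (hab : a ≤ b) {f : ℝ → ℝ} (hf : Continuous f) :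
    ∑ j, l2Norm (M.left j) (M.right j) f ^ 2 = l2Norm a b f ^ 2 := by
  rw [sq_l2Norm hab, ← M.sum_integral_cell (f := fun x => f x ^ 2) (hf.pow 2)]
  exact Finset.sum_congr rfl fun j _ => sq_l2Norm (M.left_le_right j) f

section Cyclic

variable [NeZero N]

/-- The two points coincide except after the last cell, where they are a and b, one period apart.
The offset y gives access to the neighbouring cells as well as to the interface. -/
theorem periodic_left_add_one (M : DGMesh a b N) {f : ℝ → ℝ} (hf : Function.Periodic f (b - a))
    (j : Fin N) (y : ℝ) : f (M.left (j + 1) + y) = f (M.right j + y) := by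
  obtain ⟨n, rfl⟩ : ∃ n, N = n + 1 := ⟨N - 1, (Nat.succ_pred (NeZero.ne N)).symm⟩
  by_cases hj : j = Fin.last n
  · subst hj
    have h1 : M.left (Fin.last n + 1) = a := by
      rw [Fin.last_add_one]; exact M.node_zero
    have h2 : M.right (Fin.last n) = b := by
      exact M.node_last
    rw [h1, h2, ← hf (a + y)]
    congr 1; ring
  · have : M.left (j + 1) = M.right j := by
      rw [left, right]; congr 1; ext
      simp [Fin.val_add_one_of_lt (Fin.lt_last_iff_ne_last.2 hj)]
    rw [this]

theorem periodic_left_add_one' (M : DGMesh a b N) {f : ℝ → ℝ}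
    (hf : Function.Periodic f (b - a)) (j : Fin N) : f (M.left (j + 1)) = f (M.right j) := by
  simpa using M.periodic_left_add_one hf j 0

theorem sum_add_one (f : Fin N → ℝ) : ∑ j, f (j + 1) = ∑ j, f j :=
  Equiv.sum_comp (Equiv.addRight (1 : Fin N)) f

/-! ### The bilinear form -/

theorem A_comm (M : DGMesh a b N) (w v : DGSpace N k) : M.A w v = M.A v w := by
  simp only [A]
  congr 1
  · simp only [mul_comm]
  · exact Finset.sum_congr rfl fun j _ => by ring

theorem A_add_left (M : DGMesh a b N) (w₁ w₂ v : DGSpace N k) :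
    M.A (w₁ + w₂) v = M.A w₁ v + M.A w₂ v := by
  simp only [A, avg, jump, traceMinus, tracePlus, Pi.add_apply, Submodule.coe_add, derivative_add,
    eval_add, add_mul]
  simp only [← Finset.sum_add_distrib]
  refine Finset.sum_congr rfl fun j _ => ?_
  rw [intervalIntegral.integral_add (Continuous.intervalIntegrable (by fun_prop) _ _)
      (Continuous.intervalIntegrable (by fun_prop) _ _)]
  ring

theorem A_smul_left (M : DGMesh a b N) (c : ℝ) (w v : DGSpace N k) :
    M.A (c • w) v = c * M.A w v := by
  simp only [A, avg, jump, traceMinus, tracePlus, Pi.smul_apply, Submodule.coe_smul,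
    derivative_smul, eval_smul, smul_eq_mul, mul_assoc, intervalIntegral.integral_const_mul]
  rw [mul_add, Finset.mul_sum, Finset.mul_sum]
  congr 1
  exact Finset.sum_congr rfl fun j _ => by ring

/-- Cellwise integration by parts. -/
theorem sum_integral_mul_deriv_cell (M : DGMesh a b N) {f g f' g' : Fin N → ℝ → ℝ}
    (hf : ∀ j x, HasDerivAt (f j) (f' j x) x) (hg : ∀ j x, HasDerivAt (g j) (g' j x) x)
    (hf' : ∀ j, Continuous (f' j)) (hg' : ∀ j, Continuous (g' j)) :
    ∑ j, ∫ x in (M.left j)..(M.right j), f' j x * g j x =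
      ∑ j, (f j (M.right j) * g j (M.right j)
          - f (j + 1) (M.left (j + 1)) * g (j + 1) (M.left (j + 1)))
        - ∑ j, ∫ x in (M.left j)..(M.right j), f j x * g' j x := by
  -- A cyclic shift of the left-end contributions collects both traces at the same interface.
  rw [Finset.sum_sub_distrib,
    sum_add_one fun j => f j (M.left j) * g j (M.left j), ← Finset.sum_sub_distrib,
    ← Finset.sum_sub_distrib]
  refine Finset.sum_congr rfl fun j _ => ?_
  have := intervalIntegral.integral_mul_deriv_eq_deriv_mul (a := M.left j) (b := M.right j)
    (fun x _ => hf j x) (fun x _ => hg j x) ((hf' j).intervalIntegrable _ _)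
    ((hg' j).intervalIntegrable _ _)
  linarith

/-- The jump of a product is [w v_x] = {w}[v_x] + [w]{v_x}. Integration by parts therefore produces
a term that cancels [w]{v_x} and leaves w only through its cell values and its interface averages.
-/
theorem A_eq (M : DGMesh a b N) (w v : DGSpace N k) :
    M.A w v = -(∑ j, ∫ x in (M.left j)..(M.right j),
        (w j : ℝ[X]).eval x * (derivative (derivative (v j : ℝ[X]))).eval x)
      + ∑ j, (M.avg (fun i => derivative (w i : ℝ[X])) j * M.jump (fun i => (v i : ℝ[X])) j
        - M.avg (fun i => (w i : ℝ[X])) j * M.jump (fun i => derivative (v i : ℝ[X])) j) := by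
  rw [A, M.sum_integral_mul_deriv_cell (f := fun j x => (w j : ℝ[X]).eval x)
    (g := fun j x => (derivative (v j : ℝ[X])).eval x) (fun j x => Polynomial.hasDerivAt _ _)
    (fun j x => Polynomial.hasDerivAt _ _) (fun j => by fun_prop) (fun j => by fun_prop),
    add_comm, add_sub, ← Finset.sum_add_distrib, sub_eq_add_neg, add_comm]
  congr 1
  refine Finset.sum_congr rfl fun j _ => ?_
  simp only [avg, jump, traceMinus, tracePlus]
  ring

/-- The consistency error of a piecewise polynomial approximation of a smooth periodic function. -/
theorem A_add_integral (M : DGMesh a b N) {w : ℝ → ℝ} (hw : ContDiff ℝ ∞ w)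
    (hp : Function.Periodic w (b - a)) (χ v : DGSpace N k) :
    M.A χ v + ∑ j, ∫ x in (M.left j)..(M.right j), iteratedDeriv 2 w x * (v j : ℝ[X]).eval x =
      -(∑ j, ∫ x in (M.left j)..(M.right j),
        ((χ j : ℝ[X]).eval x - w x) * (derivative (derivative (v j : ℝ[X]))).eval x)
      + ∑ j, ((M.avg (fun i => derivative (χ i : ℝ[X])) j - deriv w (M.right j))
            * M.jump (fun i => (v i : ℝ[X])) j
        - (M.avg (fun i => (χ i : ℝ[X])) j - w (M.right j))
            * M.jump (fun i => derivative (v i : ℝ[X])) j) := by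
  have hw1 := deriv_contDiff hw
  have hw2 : iteratedDeriv 2 w = deriv (deriv w) := by rw [iteratedDeriv_succ, iteratedDeriv_one]
  have hw2c : Continuous (deriv (deriv w)) := (deriv_contDiff hw1).continuous
  have h1 := M.sum_integral_mul_deriv_cell (f := fun _ => deriv w)
    (g := fun j x => (v j : ℝ[X]).eval x) (fun j x => hasDerivAt_of_contDiff hw1 x)
    (fun j x => Polynomial.hasDerivAt _ _) (fun j => hw2c) (fun j => by fun_prop)
  have h2 := M.sum_integral_mul_deriv_cell (f := fun _ => w)
    (g := fun j x => (derivative (v j : ℝ[X])).eval x) (fun j x => hasDerivAt_of_contDiff hw x)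
    (fun j x => Polynomial.hasDerivAt _ _) (fun j => hw1.continuous) (fun j => by fun_prop)
  have h3 : ∑ j, ∫ x in (M.left j)..(M.right j),
        ((χ j : ℝ[X]).eval x - w x) * (derivative (derivative (v j : ℝ[X]))).eval x
      = (∑ j, ∫ x in (M.left j)..(M.right j),
          (χ j : ℝ[X]).eval x * (derivative (derivative (v j : ℝ[X]))).eval x)
        - ∑ j, ∫ x in (M.left j)..(M.right j),
          w x * (derivative (derivative (v j : ℝ[X]))).eval x := by
    rw [← Finset.sum_sub_distrib]
    refine Finset.sum_congr rfl fun j _ => ?_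
    simp only [sub_mul]
    have := hw.continuous
    exact intervalIntegral.integral_sub (Continuous.intervalIntegrable (by fun_prop) _ _)
      (Continuous.intervalIntegrable (by fun_prop) _ _)
  rw [A_eq, hw2, h1, h2, h3]
  simp only [M.periodic_left_add_one' hp, M.periodic_left_add_one' (periodic_deriv hp)]
  have h4 : ∀ X Y P Q R S : ℝ, P + Q - R = S → -X + P + (Q - (R - Y)) = -(X - Y) + S := by
    intros; linarith
  refine h4 _ _ _ _ _ _ ?_
  rw [← Finset.sum_add_distrib, ← Finset.sum_sub_distrib]
  refine Finset.sum_congr rfl fun j _ => ?_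
  simp only [jump, traceMinus, tracePlus]
  ring

end Cyclic

/-! ### The broken `L²` space of a mesh -/

/-- Cellwise continuous functions, with the `L²` seminorm on the cells of a mesh. -/
def Broken (_ : DGMesh a b N) : Type := Fin N → C(ℝ, ℝ)

noncomputable instance (M : DGMesh a b N) : AddCommGroup M.Broken :=
  inferInstanceAs (AddCommGroup (Fin N → C(ℝ, ℝ)))

noncomputable instance (M : DGMesh a b N) : Module ℝ M.Broken :=
  inferInstanceAs (Module ℝ (Fin N → C(ℝ, ℝ)))

/-- The `L²` inner product on cellwise continuous functions. -/
noncomputable abbrev brokenCore (M : DGMesh a b N) : PreInnerProductSpace.Core ℝ M.Broken where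
  inner F G := ∑ j, ∫ x in (M.left j)..(M.right j), F j x * G j x
  conj_inner_symm F G := by simp [mul_comm]
  re_inner_nonneg F := by
    rw [RCLike.re_to_real]
    exact Finset.sum_nonneg fun j _ => intervalIntegral.integral_nonneg (M.left_le_right j)
      fun x _ => mul_self_nonneg _
  add_left F G H := by
    rw [← Finset.sum_add_distrib]
    refine Finset.sum_congr rfl fun j _ => ?_
    rw [← intervalIntegral.integral_add (Continuous.intervalIntegrable (by fun_prop) _ _)
      (Continuous.intervalIntegrable (by fun_prop) _ _)]
    exact intervalIntegral.integral_congr fun x _ => add_mul _ _ _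
  smul_left F G c := by
    rw [Finset.mul_sum]
    refine Finset.sum_congr rfl fun j _ => ?_
    rw [← intervalIntegral.integral_const_mul]
    exact intervalIntegral.integral_congr fun x _ => mul_assoc _ _ _

noncomputable instance (M : DGMesh a b N) : SeminormedAddCommGroup M.Broken :=
  @InnerProductSpace.Core.toSeminormedAddCommGroup ℝ M.Broken _ _ _ M.brokenCore

noncomputable instance (M : DGMesh a b N) : InnerProductSpace ℝ M.Broken :=
  InnerProductSpace.ofCore M.brokenCore

theorem inner_broken (M : DGMesh a b N) (F G : M.Broken) :
    Inner.inner ℝ F G = ∑ j, ∫ x in (M.left j)..(M.right j), F j x * G j x := rfl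

theorem norm_broken (M : DGMesh a b N) (F : M.Broken) :
    ‖F‖ = √(∑ j, ∫ x in (M.left j)..(M.right j), F j x ^ 2) := by
  simp only [pow_two]
  rfl

theorem sq_norm_broken (M : DGMesh a b N) (F : M.Broken) :
    ‖F‖ ^ 2 = ∑ j, l2Norm (M.left j) (M.right j) (F j) ^ 2 := by
  rw [norm_broken, Real.sq_sqrt]
  · exact Finset.sum_congr rfl fun j _ => (sq_l2Norm (M.left_le_right j) _).symm
  · exact Finset.sum_nonneg fun j _ => intervalIntegral.integral_nonneg (M.left_le_right j)
      fun x _ => sq_nonneg _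

/-- A piecewise polynomial, as an element of the broken space. -/
noncomputable def ofDG (M : DGMesh a b N) : DGSpace N k →ₗ[ℝ] M.Broken where
  toFun v := fun j => (v j : ℝ[X]).toContinuousMap
  map_add' v w := by
    funext j; ext x; exact eval_add
  map_smul' c v := by
    funext j; ext x; exact eval_smul _ _ _

theorem ofDG_apply (M : DGMesh a b N) (v : DGSpace N k) (j : Fin N) (x : ℝ) :
    M.ofDG v j x = (v j : ℝ[X]).eval x := rfl

/-- A continuous function, as an element of the broken space. -/
def ofFun (M : DGMesh a b N) (f : ℝ → ℝ) (hf : Continuous f) : M.Broken := fun _ => ⟨f, hf⟩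

theorem ofFun_apply (M : DGMesh a b N) {f : ℝ → ℝ} (hf : Continuous f) (j : Fin N) (x : ℝ) :
    M.ofFun f hf j x = f x := rfl

theorem inner_eq (M : DGMesh a b N) (v w : DGSpace N k) :
    M.inner v w = Inner.inner ℝ (M.ofDG v) (M.ofDG w) := rfl

theorem norm_ofFun (M : DGMesh a b N) {f : ℝ → ℝ} (hf : Continuous f) :
    ‖M.ofFun f hf‖ = l2Norm a b f := by
  rw [norm_broken, l2Norm, ← M.sum_integral_cell (f := fun x => f x ^ 2) (hf.pow 2)]
  rfl

theorem l2Dist_eq (M : DGMesh a b N) {f : ℝ → ℝ} (hf : Continuous f) (v : DGSpace N k) :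
    M.l2Dist f v = ‖M.ofFun f hf - M.ofDG v‖ := by
  rw [norm_broken]
  rfl

end DGMesh

/-! ### Polynomials on one cell -/

theorem finrank_degreeLE (k : ℕ) :
    Module.finrank ℝ (Polynomial.degreeLE ℝ (k : WithBot ℕ)) = k + 1 := by
  rw [← degreeLT_succ_eq_degreeLE, (degreeLTEquiv ℝ (k + 1)).finrank_eq, Module.finrank_fin_fun]

theorem eq_zero_of_eval_eq_zero_Icc {l r : ℝ} (hlr : l < r) {p : ℝ[X]}
    (h : ∀ x ∈ Icc l r, p.eval x = 0) : p = 0 :=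
  Polynomial.eq_zero_of_infinite_isRoot _ ((Icc_infinite hlr).mono fun x hx => h x hx)

theorem integral_mul_polynomial_eq_zero {l r : ℝ} {f : ℝ → ℝ} (hf : Continuous f) {m : ℕ}
    (h : ∀ i < m, ∫ x in l..r, f x * x ^ i = 0) {q : ℝ[X]} (hq : q.natDegree < m) :
    ∫ x in l..r, f x * q.eval x = 0 := by
  simp_rw [fun x => eval_eq_sum_range' hq x, Finset.mul_sum]
  rw [intervalIntegral.integral_finsetSum fun i _ =>
    Continuous.intervalIntegrable (by fun_prop) _ _]
  refine Finset.sum_eq_zero fun i hi => ?_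
  have : ∀ x, f x * (q.coeff i * x ^ i) = q.coeff i * (f x * x ^ i) := fun x => by ring
  simp_rw [this]
  rw [intervalIntegral.integral_const_mul, h i (Finset.mem_range.1 hi), mul_zero]

/-- Near-best approximation of a function by a polynomial that agrees with it at both ends of an
interval. -/
theorem exists_endpoint_interpolant {l r : ℝ} (hlr : l < r) (m : ℕ) {w : ℝ → ℝ}
    (hw : ContDiff ℝ ∞ w) :
    ∃ p : ℝ[X], p.degree ≤ (m + 1 : ℕ) ∧ p.eval l = w l ∧ p.eval r = w r ∧
      (∀ x ∈ Icc l r, |w x - p.eval x| ≤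
        2 * ((r - l) ^ (m + 1) * √(r - l) * l2Norm l r (iteratedDeriv (m + 2) w))) ∧
      ∀ x ∈ Icc l r, |deriv w x - (derivative p).eval x| ≤
        2 * ((r - l) ^ m * √(r - l) * l2Norm l r (iteratedDeriv (m + 2) w)) := by
  have hh : 0 < r - l := sub_pos.2 hlr
  set T := taylorPoly (m + 1) w l with hT
  set G := l2Norm l r (iteratedDeriv (m + 2) w) with hG
  -- Slope of the linear correction that vanishes at l and repairs the Taylor polynomial at r. It is
  -- no larger than the bound for the derivative error.
  set d := (w r - T.eval r) / (r - l) with hd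
  have hl : l ∈ Icc l r := left_mem_Icc.2 hlr.le
  have hr : r ∈ Icc l r := right_mem_Icc.2 hlr.le
  have h0 := abs_sub_taylorPoly_le hl (m + 1) hw
  have h1 := abs_deriv_sub_taylorPoly_le hl m hw
  have hdle : |d| ≤ (r - l) ^ m * √(r - l) * G := by
    rw [hd, abs_div, abs_of_pos hh, div_le_iff₀ hh]
    refine (h0 r hr).trans (le_of_eq ?_)
    ring
  refine ⟨T + C d * (X - C l), ?_, ?_, ?_, ?_, ?_⟩
  · refine (degree_add_le _ _).trans (max_le (degree_taylorPoly_le _ _ _) ?_)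
    rw [← smul_eq_C_mul]
    refine (degree_smul_le _ _).trans ?_
    rw [degree_X_sub_C]
    exact_mod_cast Nat.succ_le_succ (Nat.zero_le m)
  · simp [hT, taylorPoly_eval_self]
  · simp [hd, hh.ne']
  · intro x hx
    have e : w x - (T + C d * (X - C l)).eval x = (w x - T.eval x) - d * (x - l) := by
      simp; ring
    rw [e]
    refine (abs_sub _ _).trans ?_
    have h2 : |d * (x - l)| ≤ (r - l) ^ (m + 1) * √(r - l) * G := by
      rw [abs_mul, abs_of_nonneg (sub_nonneg.2 hx.1)]
      calc |d| * (x - l) ≤ ((r - l) ^ m * √(r - l) * G) * (r - l) :=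
            mul_le_mul hdle (by linarith [hx.2]) (by linarith [hx.1])
              ((abs_nonneg _).trans hdle)
        _ = _ := by ring
    linarith [h0 x hx]
  · intro x hx
    have e : deriv w x - (derivative (T + C d * (X - C l))).eval x
        = (deriv w x - (derivative T).eval x) - d := by
      simp; ring
    rw [e]
    refine (abs_sub _ _).trans ?_
    linarith [h1 x hx]

/-- Rolle's theorem for the primitive of f. -/
theorem exists_eq_zero_of_integral_eq_zero {l r : ℝ} (hlr : l < r) {f : ℝ → ℝ}
    (hf : Continuous f) (h : ∫ x in l..r, f x = 0) : ∃ y ∈ Icc l r, f y = 0 := by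
  have hd : ∀ x, HasDerivAt (fun y => ∫ z in l..y, f z) (f x) x := fun x =>
    intervalIntegral.integral_hasDerivAt_right (hf.intervalIntegrable _ _)
      hf.aestronglyMeasurable.stronglyMeasurableAtFilter hf.continuousAt
  obtain ⟨y, hy, h0⟩ := exists_hasDerivAt_eq_zero hlr
    (fun x _ => (hd x).continuousAt.continuousWithinAt) (by simp [h]) (fun x _ => hd x)
  exact ⟨y, ⟨hy.1.le, hy.2.le⟩, h0⟩

/-- If a polynomial has the same mean value as a function bounded by `F`, it is bounded in terms of
`F` and the `L²` norm of its derivative. -/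
theorem abs_eval_le_of_integral_eq {l r F : ℝ} (hlr : l < r) {f : ℝ → ℝ} (hf : Continuous f)
    (hF : ∀ x ∈ Icc l r, |f x| ≤ F) {ξ : ℝ[X]} (h : ∫ x in l..r, (ξ.eval x - f x) = 0) :
    ∀ x ∈ Icc l r, |ξ.eval x| ≤ F + √(r - l) * l2Norm l r (fun x => (derivative ξ).eval x) := by
  obtain ⟨y, hy, hy0⟩ := exists_eq_zero_of_integral_eq_zero hlr
    (f := fun x => ξ.eval x - f x) (by fun_prop) h
  intro x hx
  have h1 := abs_integral_le_l2Norm (f := fun x => (derivative ξ).eval x) (by fun_prop) hy hx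
  rw [intervalIntegral.integral_eq_sub_of_hasDerivAt (f := fun x => ξ.eval x)
    (fun z _ => Polynomial.hasDerivAt _ _)
    (Continuous.intervalIntegrable (by fun_prop) _ _)] at h1
  have h2 : ξ.eval x = (ξ.eval x - ξ.eval y) + f y := by linarith
  rw [h2]
  refine (abs_add_le _ _).trans ?_
  linarith [hF y hy]

namespace DGMesh

variable {a b : ℝ} {N k : ℕ} [NeZero N]

/-! ### The elliptic projection for `k ≥ 2` -/

/-- The conditions defining the projection onto `V_h^k`: prescribed moments against polynomials of
degree less than `k - 1` on every cell, and prescribed averages of value and derivative at every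
interface. -/
structure IsEllipticProjection (M : DGMesh a b N) (w : ℝ → ℝ) (χ : DGSpace N k) : Prop where
  moment : ∀ j, ∀ i < k - 1,
    ∫ x in (M.left j)..(M.right j), ((χ j : ℝ[X]).eval x - w x) * x ^ i = 0
  avg_eq : ∀ j, M.avg (fun i => (χ i : ℝ[X])) j = w (M.right j)
  avg_derivative_eq : ∀ j, M.avg (fun i => derivative (χ i : ℝ[X])) j = deriv w (M.right j)

theorem natDegree_derivative_derivative_lt (hk : 2 ≤ k)
    (v : Polynomial.degreeLE ℝ (k : WithBot ℕ)) :
    (derivative (derivative (v : ℝ[X]))).natDegree < k - 1 := by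
  have h1 := natDegree_derivative_le (v : ℝ[X])
  have h2 := natDegree_derivative_le (derivative (v : ℝ[X]))
  have h3 := natDegree_le_iff_degree_le.2 (mem_degreeLE.1 v.2)
  omega

theorem IsEllipticProjection.integral_eq_zero {M : DGMesh a b N} {w : ℝ → ℝ} {χ : DGSpace N k}
    (h : M.IsEllipticProjection w χ) (hw : Continuous w) (j : Fin N) {q : ℝ[X]}
    (hq : q.natDegree < k - 1) :
    ∫ x in (M.left j)..(M.right j), ((χ j : ℝ[X]).eval x - w x) * q.eval x = 0 :=
  integral_mul_polynomial_eq_zero (f := fun x => (χ j : ℝ[X]).eval x - w x) (by fun_prop)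
    (h.moment j) hq

/-- The second derivative of v has degree below k - 1, so the prescribed moments and averages remove
every term of `A_add_integral`. -/
theorem IsEllipticProjection.A_add_integral_eq_zero {M : DGMesh a b N} {w : ℝ → ℝ}
    {χ : DGSpace N k} (h : M.IsEllipticProjection w χ) (hk : 2 ≤ k) (hw : ContDiff ℝ ∞ w)
    (hp : Function.Periodic w (b - a)) (v : DGSpace N k) :
    M.A χ v + ∑ j, ∫ x in (M.left j)..(M.right j), iteratedDeriv 2 w x * (v j : ℝ[X]).eval x
      = 0 := by
  rw [M.A_add_integral hw hp]
  simp [h.avg_eq, h.avg_derivative_eq, h.integral_eq_zero hw.continuous _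
    (natDegree_derivative_derivative_lt hk (v _))]

theorem IsEllipticProjection.sub {M : DGMesh a b N} {w₁ w₂ : ℝ → ℝ} {χ₁ χ₂ : DGSpace N k}
    (h₁ : M.IsEllipticProjection w₁ χ₁) (h₂ : M.IsEllipticProjection w₂ χ₂)
    (hw₁ : ContDiff ℝ ∞ w₁) (hw₂ : ContDiff ℝ ∞ w₂) :
    M.IsEllipticProjection (fun x => w₁ x - w₂ x) (χ₁ - χ₂) where
  moment j i hi := by
    have e : ∀ x, (((χ₁ - χ₂) j : ℝ[X]).eval x - (w₁ x - w₂ x)) * x ^ i =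
        ((χ₁ j : ℝ[X]).eval x - w₁ x) * x ^ i - ((χ₂ j : ℝ[X]).eval x - w₂ x) * x ^ i := by
      intro x; simp; ring
    simp_rw [e]
    have := hw₁.continuous
    have := hw₂.continuous
    rw [intervalIntegral.integral_sub (Continuous.intervalIntegrable (by fun_prop) _ _)
      (Continuous.intervalIntegrable (by fun_prop) _ _), h₁.moment j i hi, h₂.moment j i hi,
      sub_zero]
  avg_eq j := by
    rw [← h₁.avg_eq, ← h₂.avg_eq]
    simp [avg, traceMinus, tracePlus]; ring
  avg_derivative_eq j := by
    have hd : deriv (fun x => w₁ x - w₂ x) (M.right j)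
        = deriv w₁ (M.right j) - deriv w₂ (M.right j) :=
      ((hasDerivAt_of_contDiff hw₁ _).sub (hasDerivAt_of_contDiff hw₂ _)).deriv
    rw [hd, ← h₁.avg_derivative_eq, ← h₂.avg_derivative_eq]
    simp [avg, traceMinus, tracePlus]; ring

/-- The energy identity for a piecewise polynomial. -/
theorem sum_sq_l2Norm_derivative (M : DGMesh a b N) (ξ : Fin N → ℝ[X]) :
    ∑ j, l2Norm (M.left j) (M.right j) (fun x => (derivative (ξ j)).eval x) ^ 2 =
      ∑ j, (-(∫ x in (M.left j)..(M.right j),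
          (ξ j).eval x * (derivative (derivative (ξ j))).eval x)
        - (M.avg ξ j * M.jump (fun i => derivative (ξ i)) j
          + M.jump ξ j * M.avg (fun i => derivative (ξ i)) j)) := by
  have h := M.sum_integral_mul_deriv_cell (f := fun j x => (ξ j).eval x)
    (g := fun j x => (derivative (ξ j)).eval x) (fun j x => Polynomial.hasDerivAt _ _)
    (fun j x => Polynomial.hasDerivAt _ _) (fun j => by fun_prop) (fun j => by fun_prop)
  have h1 : ∑ j, l2Norm (M.left j) (M.right j) (fun x => (derivative (ξ j)).eval x) ^ 2 =
      ∑ j, ∫ x in (M.left j)..(M.right j), (derivative (ξ j)).eval x * (derivative (ξ j)).eval x := by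
    refine Finset.sum_congr rfl fun j _ => ?_
    rw [sq_l2Norm (M.left_le_right j)]
    simp only [pow_two]
  rw [h1, h, ← Finset.sum_sub_distrib]
  refine Finset.sum_congr rfl fun j _ => ?_
  simp only [avg, jump, traceMinus, tracePlus]
  ring

/-- Young's inequality puts 1/2 of each D j ^ 2 and 1/4 of its cyclic neighbour on the right. The
quarter left over after summation explains the factor 4 in 16 K² + 64 = 4 (4 K² + 16). -/
theorem sum_le_of_energy {K : ℝ} {g D : Fin N → ℝ}
    (h : ∑ j, D j ^ 2 ≤ ∑ j, (2 * K * g j * D j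
      + (g j + g (j + 1)) * (2 * (g j + g (j + 1)) + (D j + D (j + 1))))) :
    ∑ j, D j ^ 2 ≤ (16 * K ^ 2 + 64) * ∑ j, g j ^ 2 := by
  have h1 : ∀ j, 2 * K * g j * D j
      + (g j + g (j + 1)) * (2 * (g j + g (j + 1)) + (D j + D (j + 1))) ≤
      (4 * K ^ 2 + 8) * g j ^ 2 + 8 * g (j + 1) ^ 2 + 1 / 2 * D j ^ 2
        + 1 / 4 * D (j + 1) ^ 2 := by
    intro j
    nlinarith [sq_nonneg (2 * K * g j - D j / 2), sq_nonneg (g j - g (j + 1)),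
      sq_nonneg (D j - D (j + 1)), sq_nonneg (4 * (g j + g (j + 1)) - (D j + D (j + 1)))]
  have h2 := h.trans (Finset.sum_le_sum fun j _ => h1 j)
  simp only [Finset.sum_add_distrib, ← Finset.mul_sum] at h2
  rw [sum_add_one fun j => g j ^ 2, sum_add_one fun j => D j ^ 2] at h2
  linarith

/-- The projection is compared with the local interpolant p that matches w at the cell ends. For ξ =
χ - p the interface average vanishes, which removes one of the two interface terms of the energy
identity. The other pairs the jump of ξ with the average of ξ', and the latter is a pure
interpolation error. The hypothesis 1 ≤ m provides the zeroth moment, through which ξ itself is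
controlled by ξ'. -/
theorem exists_l2Dist_ellipticProjection_le (m : ℕ) (hm : 1 ≤ m) :
    ∃ K : ℝ, 0 ≤ K ∧ ∀ {a b : ℝ}, a < b → ∀ {N : ℕ} [NeZero N] (M : DGMesh a b N) {w : ℝ → ℝ},
      ContDiff ℝ ∞ w → Function.Periodic w (b - a) → ∀ {χ : DGSpace N (m + 1)},
      M.IsEllipticProjection w χ →
      M.l2Dist w χ ≤ K * M.h ^ (m + 2) * l2Norm a b (iteratedDeriv (m + 2) w) := by
  obtain ⟨K, hK0, hK⟩ := exists_l2Norm_derivative_le (m + 1)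
  refine ⟨√(160 + 32 * K ^ 2), Real.sqrt_nonneg _, fun {a b} hab {N} _ M {w} hw hp {χ} hχ => ?_⟩
  choose p hpdeg hpl hpr hp0 hp1 using fun j =>
    exists_endpoint_interpolant (M.left_lt_right j) m hw
  set ξ : Fin N → ℝ[X] := fun j => (χ j : ℝ[X]) - p j with hξ
  set G : Fin N → ℝ := fun j => l2Norm (M.left j) (M.right j) (iteratedDeriv (m + 2) w) with hG
  set D : Fin N → ℝ := fun j => l2Norm (M.left j) (M.right j) fun x => (derivative (ξ j)).eval x
    with hD
  set g : Fin N → ℝ := fun j => M.h ^ (m + 1) * G j with hg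
  have hG0 : ∀ j, 0 ≤ G j := fun j => l2Norm_nonneg _ _ _
  have hD0 : ∀ j, 0 ≤ D j := fun j => l2Norm_nonneg _ _ _
  have hh0 := M.h_nonneg
  have hg0 : ∀ j, 0 ≤ g j := fun j => mul_nonneg (by positivity) (hG0 j)
  set s := √M.h with hs
  have hs0 : 0 ≤ s := Real.sqrt_nonneg _
  have hss : s * s = M.h := Real.mul_self_sqrt hh0
  have hH0 : ∀ j, 0 < M.right j - M.left j := M.cellSize_pos
  have hH : ∀ j, M.right j - M.left j ≤ M.h := M.cellSize_le_h
  have hsH : ∀ j, √(M.right j - M.left j) ≤ s := fun j => Real.sqrt_le_sqrt (hH j)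
  have hl : ∀ j, M.left j ∈ Icc (M.left j) (M.right j) := fun j => left_mem_Icc.2 (M.left_le_right j)
  have hr : ∀ j, M.right j ∈ Icc (M.left j) (M.right j) :=
    fun j => right_mem_Icc.2 (M.left_le_right j)
  have hwc := hw.continuous
  have hmom : ∀ j (q : ℝ[X]), q.natDegree < m →
      ∫ x in (M.left j)..(M.right j), ((ξ j).eval x - (w x - (p j).eval x)) * q.eval x = 0 := by
    intro j q hq
    rw [← hχ.integral_eq_zero hwc j (q := q) (by simpa using hq)]
    refine intervalIntegral.integral_congr fun x _ => ?_
    simp only [hξ, eval_sub]; ring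
  have hξdeg : ∀ j, (ξ j).degree ≤ (m + 1 : ℕ) := fun j =>
    (degree_sub_le _ _).trans (max_le (mem_degreeLE.1 (χ j).2) (hpdeg j))
  have hξ2 : ∀ j, (derivative (derivative (ξ j))).natDegree < m := fun j => by
    have := natDegree_derivative_derivative_lt (k := m + 1) (by omega)
      ⟨ξ j, mem_degreeLE.2 (hξdeg j)⟩
    simpa using this
  have hξsup : ∀ j, ∀ x ∈ Icc (M.left j) (M.right j), |(ξ j).eval x| ≤ s * (2 * g j + D j) := by
    intro j x hx
    refine (abs_eval_le_of_integral_eq (M.left_lt_right j)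
      (f := fun x => w x - (p j).eval x) (by fun_prop) (hp0 j)
      (by simpa using hmom j 1 (by rw [natDegree_one]; exact hm)) x hx).trans ?_
    have h1 : (M.right j - M.left j) ^ (m + 1) * √(M.right j - M.left j) * G j
        ≤ M.h ^ (m + 1) * s * G j := by
      have := hG0 j
      have := (hH0 j).le
      gcongr
      · exact hH j
      · exact hsH j
    have h2 : √(M.right j - M.left j) * D j ≤ s * D j :=
      mul_le_mul_of_nonneg_right (hsH j) (hD0 j)
    refine (add_le_add (mul_le_mul_of_nonneg_left h1 zero_le_two) h2).trans (le_of_eq ?_)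
    simp only [hg]; ring
  have hint : ∀ j, |∫ x in (M.left j)..(M.right j),
      (ξ j).eval x * (derivative (derivative (ξ j))).eval x| ≤ 2 * K * g j * D j := by
    intro j
    -- The moment conditions allow ξ to be replaced by the interpolation error, because ξ'' has
    -- degree below m.
    have e : ∫ x in (M.left j)..(M.right j),
        (ξ j).eval x * (derivative (derivative (ξ j))).eval x =
        ∫ x in (M.left j)..(M.right j),
          (w x - (p j).eval x) * (derivative (derivative (ξ j))).eval x := by
      rw [← sub_eq_zero, ← intervalIntegral.integral_sub
        (Continuous.intervalIntegrable (by fun_prop) _ _)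
        (Continuous.intervalIntegrable (by fun_prop) _ _), ← hmom j _ (hξ2 j)]
      exact intervalIntegral.integral_congr fun x _ => by ring
    rw [e]
    have h1 := abs_integral_mul_le_l2Norm (M.left_le_right j)
      (f := fun x => w x - (p j).eval x)
      (g := fun x => (derivative (derivative (ξ j))).eval x) (by fun_prop) (by fun_prop)
    have hF0 := mul_nonneg (mul_nonneg (pow_nonneg (hH0 j).le (m + 1))
      (Real.sqrt_nonneg (M.right j - M.left j))) (hG0 j)
    have h2 := l2Norm_le_of_abs_le (M.left_le_right j) (f := fun x => w x - (p j).eval x)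
      (by fun_prop) (mul_nonneg zero_le_two hF0) (hp0 j)
    have h3 := hK _ _ (M.left_lt_right j) (derivative (ξ j))
      (degree_derivative_le.trans (hξdeg j))
    set E := l2Norm (M.left j) (M.right j) fun x => (derivative (derivative (ξ j))).eval x
    have hE0 : 0 ≤ E := l2Norm_nonneg _ _ _
    have hsq : √(M.right j - M.left j) * √(M.right j - M.left j) = M.right j - M.left j :=
      Real.mul_self_sqrt (hH0 j).le
    calc _ ≤ _ := h1
      _ ≤ (√(M.right j - M.left j) * (2 * ((M.right j - M.left j) ^ (m + 1)
            * √(M.right j - M.left j) * G j))) * E := mul_le_mul_of_nonneg_right h2 hE0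
      _ = (√(M.right j - M.left j) * √(M.right j - M.left j)) * (2 * (M.right j - M.left j) ^ (m + 1)
            * G j * E) := by ring
      -- The inverse inequality is paid for by the length of the same cell, so cells of very
      -- different sizes are allowed.
      _ = 2 * (M.right j - M.left j) ^ (m + 1) * G j * ((M.right j - M.left j) * E) := by
            rw [hsq]; ring
      _ ≤ 2 * M.h ^ (m + 1) * G j * (K * D j) := by
            have := hG0 j
            have := (hH0 j).le
            have h4 := hH j
            gcongr
      _ = _ := by simp only [hg]; ring
  have havg : ∀ j, M.avg ξ j = 0 := by
    intro j
    have h1 := hχ.avg_eq j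
    simp only [avg, traceMinus, tracePlus] at h1 ⊢
    simp only [hξ, eval_sub, hpl, hpr, M.periodic_left_add_one' hp]
    linarith
  have havg' : ∀ j, |M.avg (fun i => derivative (ξ i)) j| ≤ M.h ^ m * s * (G j + G (j + 1)) := by
    intro j
    have h1 := hχ.avg_derivative_eq j
    have hb : ∀ i x, x ∈ Icc (M.left i) (M.right i) → |deriv w x - (derivative (p i)).eval x| ≤
        2 * (M.h ^ m * s * G i) := by
      intro i x hx
      refine (hp1 i x hx).trans ?_
      have := hG0 i
      have := (hH0 i).le
      have h4 := hH i
      have h5 := hsH i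
      gcongr
    have h2 := hb j _ (hr j)
    have h3 := hb (j + 1) _ (hl (j + 1))
    have e : M.avg (fun i => derivative (ξ i)) j =
        ((deriv w (M.right j) - (derivative (p j)).eval (M.right j))
        + (deriv w (M.left (j + 1)) - (derivative (p (j + 1))).eval (M.left (j + 1)))) / 2 := by
      simp only [avg, traceMinus, tracePlus] at h1 ⊢
      rw [M.periodic_left_add_one' (periodic_deriv hp)]
      simp only [hξ, derivative_sub, eval_sub]
      linarith
    rw [e, abs_div, abs_two, div_le_iff₀ two_pos]
    refine (abs_add_le _ _).trans ?_
    linarith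
  have henergy : ∑ j, D j ^ 2 ≤ (16 * K ^ 2 + 64) * ∑ j, g j ^ 2 := by
    refine sum_le_of_energy ?_
    rw [M.sum_sq_l2Norm_derivative ξ]
    refine Finset.sum_le_sum fun j _ => ?_
    rw [havg, zero_mul, zero_add]
    have h1 := (abs_le.1 (hint j)).1
    have hj : |M.jump ξ j| ≤ s * (2 * (g j + g (j + 1)) + (D j + D (j + 1))) := by
      have h2 := hξsup j _ (hr j)
      have h3 := hξsup (j + 1) _ (hl (j + 1))
      refine (abs_sub _ _).trans ?_
      simp only [traceMinus, tracePlus]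
      linarith
    -- The jump carries √h and the derivative average carries h^m √h. Together they make up the
    -- h^{m+1} in g.
    have h4 : |M.jump ξ j * M.avg (fun i => derivative (ξ i)) j| ≤
        (g j + g (j + 1)) * (2 * (g j + g (j + 1)) + (D j + D (j + 1))) := by
      rw [abs_mul]
      refine (mul_le_mul hj (havg' j) (abs_nonneg _) ((abs_nonneg _).trans hj)).trans
        (le_of_eq ?_)
      have : M.h ^ (m + 1) = M.h ^ m * (s * s) := by rw [hss]; ring
      simp only [hg, this]; ring
    linarith [(abs_le.1 h4).1]
  have hcell : ∀ j, ∫ x in (M.left j)..(M.right j), (w x - (χ j : ℝ[X]).eval x) ^ 2 ≤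
      M.h ^ 2 * (32 * g j ^ 2 + 2 * D j ^ 2) := by
    intro j
    have hb : ∀ x ∈ Icc (M.left j) (M.right j), |w x - (χ j : ℝ[X]).eval x| ≤
        s * (4 * g j + D j) := by
      intro x hx
      have e : w x - (χ j : ℝ[X]).eval x = (w x - (p j).eval x) - (ξ j).eval x := by
        simp only [hξ, eval_sub]; ring
      rw [e]
      refine (abs_sub _ _).trans ?_
      have h1 := hξsup j x hx
      have h2 := hp0 j x hx
      have h3 : (M.right j - M.left j) ^ (m + 1) * √(M.right j - M.left j) * G j
          ≤ M.h ^ (m + 1) * s * G j := by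
        have := hG0 j
        have := (hH0 j).le
        have h4 := hH j
        have h5 := hsH j
        gcongr
      have h4 : M.h ^ (m + 1) * s * G j = s * g j := by simp only [hg]; ring
      linarith
    have hgD : 0 ≤ 4 * g j + D j := by linarith [hg0 j, hD0 j]
    have h1 := l2Norm_le_of_abs_le (M.left_le_right j)
      (f := fun x => w x - (χ j : ℝ[X]).eval x) (by fun_prop) (mul_nonneg hs0 hgD) hb
    rw [← sq_l2Norm (M.left_le_right j)]
    have h2 : l2Norm (M.left j) (M.right j) (fun x => w x - (χ j : ℝ[X]).eval x) ≤
        M.h * (4 * g j + D j) := by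
      refine h1.trans ?_
      rw [← hss, mul_assoc]
      exact mul_le_mul_of_nonneg_right (hsH j) (mul_nonneg hs0 hgD)
    calc _ ≤ (M.h * (4 * g j + D j)) ^ 2 := pow_le_pow_left₀ (l2Norm_nonneg _ _ _) h2 2
      _ = M.h ^ 2 * (4 * g j + D j) ^ 2 := by ring
      _ ≤ _ := by
        refine mul_le_mul_of_nonneg_left ?_ (sq_nonneg _)
        nlinarith [sq_nonneg (4 * g j - D j)]
  have hsumg : ∑ j, g j ^ 2 = (M.h ^ (m + 1)) ^ 2 * l2Norm a b (iteratedDeriv (m + 2) w) ^ 2 := by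
    rw [← M.sum_sq_l2Norm_cell hab.le (iteratedDeriv_contDiff hw _).continuous, Finset.mul_sum]
    exact Finset.sum_congr rfl fun j _ => mul_pow _ _ _
  have hL := l2Norm_nonneg a b (iteratedDeriv (m + 2) w)
  rw [l2Dist]
  refine Real.sqrt_le_iff.2 ⟨by positivity, (Finset.sum_le_sum fun j _ => hcell j).trans ?_⟩
  rw [← Finset.mul_sum, Finset.sum_add_distrib, ← Finset.mul_sum, ← Finset.mul_sum, mul_pow,
    mul_pow, Real.sq_sqrt (by positivity)]
  calc M.h ^ 2 * (32 * ∑ j, g j ^ 2 + 2 * ∑ j, D j ^ 2)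
      ≤ M.h ^ 2 * (32 * ∑ j, g j ^ 2 + 2 * ((16 * K ^ 2 + 64) * ∑ j, g j ^ 2)) := by gcongr
    _ = M.h ^ 2 * ((160 + 32 * K ^ 2) * ∑ j, g j ^ 2) := by ring
    _ = _ := by rw [hsumg]; ring

/-- Moments and interface averages of a piecewise polynomial. -/
noncomputable def ellipticData (M : DGMesh a b N) (k : ℕ) :
    DGSpace N k →ₗ[ℝ] Fin N → (Fin (k - 1) → ℝ) × ℝ × ℝ where
  toFun χ j := (fun i => ∫ x in (M.left j)..(M.right j), (χ j : ℝ[X]).eval x * x ^ (i : ℕ),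
    M.avg (fun i => (χ i : ℝ[X])) j, M.avg (fun i => derivative (χ i : ℝ[X])) j)
  map_add' χ₁ χ₂ := by
    funext j
    refine Prod.ext (funext fun i => ?_) (Prod.ext ?_ ?_)
    · simp only [Pi.add_apply, Submodule.coe_add, eval_add, add_mul, Prod.fst_add]
      exact intervalIntegral.integral_add (Continuous.intervalIntegrable (by fun_prop) _ _)
        (Continuous.intervalIntegrable (by fun_prop) _ _)
    · simp [avg, traceMinus, tracePlus]; ring
    · simp [avg, traceMinus, tracePlus]; ring
  map_smul' c χ := by
    funext j
    refine Prod.ext (funext fun i => ?_) (Prod.ext ?_ ?_)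
    · simp [mul_assoc]
    · simp [avg, traceMinus, tracePlus]; ring
    · simp [avg, traceMinus, tracePlus]; ring

/-- Both sides have dimension N (k + 1), so injectivity suffices. It follows from the error estimate
with w = 0, for which a projection has distance 0 from the zero function. -/
theorem ellipticData_surjective (M : DGMesh a b N) (hab : a < b) (hk : 2 ≤ k) :
    Function.Surjective (M.ellipticData k) := by
  have hfin : Module.finrank ℝ (DGSpace N k) =
      Module.finrank ℝ (Fin N → (Fin (k - 1) → ℝ) × ℝ × ℝ) := by
    rw [Module.finrank_pi_fintype, Module.finrank_pi_fintype]
    simp only [finrank_degreeLE, Module.finrank_prod, Module.finrank_fin_fun, Module.finrank_self]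
    congr 1; funext; omega
  refine (LinearMap.injective_iff_surjective_of_finrank_eq_finrank hfin).1 ?_
  rw [injective_iff_map_eq_zero]
  intro χ hχ
  obtain ⟨m, rfl⟩ : ∃ m, k = m + 1 := ⟨k - 1, by omega⟩
  obtain ⟨K, -, hK⟩ := exists_l2Dist_ellipticProjection_le m (by omega)
  have hd : deriv (fun _ : ℝ => (0 : ℝ)) = fun _ => 0 := deriv_const' _
  have hproj : M.IsEllipticProjection (fun _ => 0) χ := by
    refine ⟨fun j i hi => ?_, fun j => ?_, fun j => ?_⟩
    · have := congrFun (congrArg Prod.fst (congrFun hχ j)) ⟨i, hi⟩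
      simpa [ellipticData] using this
    · exact congrArg (fun z => z.2.1) (congrFun hχ j)
    · rw [hd]; exact congrArg (fun z => z.2.2) (congrFun hχ j)
  have h0 := hK hab M (w := fun _ => 0) contDiff_const (fun _ => rfl) hproj
  have hz : l2Norm a b (iteratedDeriv (m + 2) fun _ : ℝ => (0 : ℝ)) = 0 := by
    simp [l2Norm]
  rw [hz, mul_zero, M.l2Dist_eq continuous_const] at h0
  have h1 := M.sq_norm_broken (M.ofFun (fun _ => 0) continuous_const - M.ofDG χ)
  rw [le_antisymm h0 (norm_nonneg _), zero_pow two_ne_zero, eq_comm,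
    Finset.sum_eq_zero_iff_of_nonneg fun j _ => sq_nonneg _] at h1
  funext j
  refine Subtype.ext (eq_zero_of_eval_eq_zero_Icc (M.left_lt_right j) fun x hx => ?_)
  have h2 := eq_zero_of_l2Norm_eq_zero (M.left_lt_right j) (ContinuousMap.continuous _)
    (pow_eq_zero_iff two_ne_zero |>.1 (h1 j (Finset.mem_univ j))) x hx
  have h3 : (M.ofFun (fun _ => 0) continuous_const - M.ofDG χ) j x = 0 - (χ j : ℝ[X]).eval x := rfl
  rw [h3] at h2
  linarith

theorem exists_ellipticProjection (M : DGMesh a b N) (hab : a < b) (hk : 2 ≤ k) {w : ℝ → ℝ}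
    (hw : Continuous w) : ∃ χ : DGSpace N k, M.IsEllipticProjection w χ := by
  obtain ⟨χ, hχ⟩ := M.ellipticData_surjective hab hk fun j =>
    (fun i => ∫ x in (M.left j)..(M.right j), w x * x ^ (i : ℕ), w (M.right j),
      deriv w (M.right j))
  refine ⟨χ, fun j i hi => ?_, fun j => congrArg (fun z => z.2.1) (congrFun hχ j),
    fun j => congrArg (fun z => z.2.2) (congrFun hχ j)⟩
  have h1 : ∫ x in (M.left j)..(M.right j), (χ j : ℝ[X]).eval x * x ^ i =
      ∫ x in (M.left j)..(M.right j), w x * x ^ i :=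
    congrFun (congrArg Prod.fst (congrFun hχ j)) ⟨i, hi⟩
  simp only [sub_mul]
  rw [intervalIntegral.integral_sub (Continuous.intervalIntegrable (by fun_prop) _ _)
    (Continuous.intervalIntegrable (by fun_prop) _ _), h1, sub_self]

end DGMesh

/-! ### Difference formulas -/

/-- Both combinations vanish on cubics, so w may be replaced by its Taylor remainder at l. The
coefficients 1, 3, 3, 1 add up to 8. Values of the remainder are at most 3h times the bound for its
derivative, whence 26 = 8 · 3 + 4/2. -/
theorem cubic_difference_defect {w : ℝ → ℝ} (hw : ContDiff ℝ ∞ w) {h : ℝ} (hh : 0 < h) (l : ℝ) :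
    |deriv w (l - h) - 3 * deriv w l + 3 * deriv w (l + h) - deriv w (l + 2 * h)| ≤
        8 * ((3 * h) ^ 2 * √(3 * h) * l2Norm (l - h) (l + 2 * h) (iteratedDeriv 4 w)) ∧
      |(w (l + 2 * h) - 3 * w (l + h) + 3 * w l - w (l - h))
          - h / 2 * (deriv w (l - h) - deriv w l - deriv w (l + h) + deriv w (l + 2 * h))| ≤
        26 * h * ((3 * h) ^ 2 * √(3 * h) * l2Norm (l - h) (l + 2 * h) (iteratedDeriv 4 w)) := by
  set T := taylorPoly 3 w l with hT
  have hl : l ∈ Icc (l - h) (l + 2 * h) := ⟨by linarith, by linarith⟩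
  have h0 := abs_sub_taylorPoly_le hl 3 hw
  have h1 := abs_deriv_sub_taylorPoly_le hl 2 hw
  rw [show l + 2 * h - (l - h) = 3 * h by ring] at h0 h1
  norm_num only at h0 h1
  set κ := (3 * h) ^ 2 * √(3 * h) * l2Norm (l - h) (l + 2 * h) (iteratedDeriv 4 w) with hκ
  have h0' : ∀ x ∈ Icc (l - h) (l + 2 * h), |w x - T.eval x| ≤ 3 * h * κ := fun x hx =>
    (h0 x hx).trans (le_of_eq (by rw [hκ]; ring))
  have m0 : l - h ∈ Icc (l - h) (l + 2 * h) := ⟨by linarith, by linarith⟩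
  have m2 : l + h ∈ Icc (l - h) (l + 2 * h) := ⟨by linarith, by linarith⟩
  have m3 : l + 2 * h ∈ Icc (l - h) (l + 2 * h) := ⟨by linarith, by linarith⟩
  obtain ⟨t0, t1, t2, t3, ht, ht'⟩ : ∃ t0 t1 t2 t3 : ℝ,
      (∀ x, T.eval x = t0 + t1 * (x - l) + t2 * (x - l) ^ 2 + t3 * (x - l) ^ 3) ∧
      ∀ x, (derivative T).eval x = t1 + 2 * t2 * (x - l) + 3 * t3 * (x - l) ^ 2 := by
    refine ⟨iteratedDeriv 0 w l / Nat.factorial 0, iteratedDeriv 1 w l / Nat.factorial 1,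
      iteratedDeriv 2 w l / Nat.factorial 2, iteratedDeriv 3 w l / Nat.factorial 3,
      fun x => ?_, fun x => ?_⟩
    · simp [hT, taylorPoly, Finset.sum_range_succ]
    · simp only [hT, taylorPoly, Finset.sum_range_succ, Finset.sum_range_zero, derivative_add,
        derivative_C_mul, derivative_X_sub_C_pow, eval_add, eval_mul, eval_C, eval_pow, eval_sub,
        eval_X, derivative_zero, eval_zero]
      push_cast
      ring
  have a0 := abs_le.1 (h0' _ m0)
  have a1 := abs_le.1 (h0' _ hl)
  have a2 := abs_le.1 (h0' _ m2)
  have a3 := abs_le.1 (h0' _ m3)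
  have b0 := abs_le.1 (h1 _ m0)
  have b1 := abs_le.1 (h1 _ hl)
  have b2 := abs_le.1 (h1 _ m2)
  have b3 := abs_le.1 (h1 _ m3)
  constructor
  · have e : deriv w (l - h) - 3 * deriv w l + 3 * deriv w (l + h) - deriv w (l + 2 * h) =
        (deriv w (l - h) - (derivative T).eval (l - h)) - 3 * (deriv w l - (derivative T).eval l)
        + 3 * (deriv w (l + h) - (derivative T).eval (l + h))
        - (deriv w (l + 2 * h) - (derivative T).eval (l + 2 * h)) := by
      simp only [ht']; ring
    rw [e, abs_le]
    constructor <;> linarith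
  · have e : (w (l + 2 * h) - 3 * w (l + h) + 3 * w l - w (l - h))
          - h / 2 * (deriv w (l - h) - deriv w l - deriv w (l + h) + deriv w (l + 2 * h)) =
        ((w (l + 2 * h) - T.eval (l + 2 * h)) - 3 * (w (l + h) - T.eval (l + h))
          + 3 * (w l - T.eval l) - (w (l - h) - T.eval (l - h)))
        - h / 2 * ((deriv w (l - h) - (derivative T).eval (l - h))
          - (deriv w l - (derivative T).eval l) - (deriv w (l + h) - (derivative T).eval (l + h))
          + (deriv w (l + 2 * h) - (derivative T).eval (l + 2 * h))) := by
      simp only [ht, ht']; ring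
    rw [e]
    refine (abs_sub _ _).trans ?_
    rw [abs_mul, abs_of_pos (half_pos hh)]
    have e1 : |(w (l + 2 * h) - T.eval (l + 2 * h)) - 3 * (w (l + h) - T.eval (l + h))
          + 3 * (w l - T.eval l) - (w (l - h) - T.eval (l - h))| ≤ 24 * h * κ := by
      rw [abs_le]; constructor <;> linarith
    have e2 : |(deriv w (l - h) - (derivative T).eval (l - h))
          - (deriv w l - (derivative T).eval l) - (deriv w (l + h) - (derivative T).eval (l + h))
          + (deriv w (l + 2 * h) - (derivative T).eval (l + 2 * h))| ≤ 4 * κ := by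
      rw [abs_le]; constructor <;> linarith
    have e3 := mul_le_mul_of_nonneg_left e2 (half_pos hh).le
    linarith

/-- With end values α and β the squared norm is h (α² + αβ + β²) / 3, a definite quadratic form.
This bounds traces of linear functions by the cell norm with an explicit constant. -/
theorem sqrt_mul_abs_le_l2Norm_linear {l h : ℝ} (hh : 0 < h) (α σ : ℝ) :
    √h * (|α| + |α + σ * h|) ≤ 4 * l2Norm l (l + h) (fun x => α + σ * (x - l)) := by
  have hint : ∫ x in l..(l + h), (α + σ * (x - l)) ^ 2 =
      h / 3 * (α ^ 2 + α * (α + σ * h) + (α + σ * h) ^ 2) := by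
    have hd : ∀ x, HasDerivAt (fun x => α ^ 2 * (x - l) + α * σ * (x - l) ^ 2
        + σ ^ 2 * (x - l) ^ 3 / 3) ((α + σ * (x - l)) ^ 2) x := by
      intro x
      have h0 := (hasDerivAt_id x).sub_const l
      have := ((h0.const_mul (α ^ 2)).add ((h0.pow 2).const_mul (α * σ))).add
        (((h0.pow 3).const_mul (σ ^ 2)).div_const 3)
      refine this.congr_deriv ?_
      simp; ring
    rw [intervalIntegral.integral_eq_sub_of_hasDerivAt (fun x _ => hd x)
      (Continuous.intervalIntegrable (by fun_prop) _ _)]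
    ring
  have h4 : (4 : ℝ) = √16 := by rw [show (16 : ℝ) = 4 ^ 2 by norm_num, Real.sqrt_sq (by norm_num)]
  have hs : 0 ≤ |α| + |α + σ * h| := by positivity
  rw [l2Norm, hint, h4, ← Real.sqrt_mul (by norm_num), ← Real.sqrt_sq hs, ← Real.sqrt_mul hh.le]
  refine Real.sqrt_le_sqrt ?_
  set β := α + σ * h
  have h1 : (|α| + |β|) ^ 2 ≤ 2 * (α ^ 2 + β ^ 2) := by
    nlinarith [sq_nonneg (|α| - |β|), sq_abs α, sq_abs β]
  have h2 : 2 * (α ^ 2 + β ^ 2) ≤ 16 / 3 * (α ^ 2 + α * β + β ^ 2) := by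
    nlinarith [sq_nonneg (α + β), sq_nonneg α, sq_nonneg β]
  have := mul_le_mul_of_nonneg_left (h1.trans h2) hh.le
  linarith

namespace DGMesh

variable {a b : ℝ} {N : ℕ}

/-! ### A quasi-interpolant for `k = 1` on uniform meshes -/

theorem IsUniform.right_eq {M : DGMesh a b N} (hM : M.IsUniform) (j : Fin N) :
    M.right j = M.left j + M.h := by
  have : M.h = M.cellSize j := by
    have : Nonempty (Fin N) := ⟨j⟩
    rw [h, show M.cellSize = fun _ => M.cellSize j from funext fun i => hM i j, ciSup_const]
  rw [this, cellSize]; ring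

/-- The piecewise linear quasi-interpolant of `w` built from the values and derivatives of `w` at
the nodes. -/
noncomputable def quasiInterpolant (M : DGMesh a b N) (w : ℝ → ℝ) : DGSpace N 1 := fun j =>
  ⟨C ((w (M.left j) + w (M.right j)) / 2
        - M.h / 2 * deriv w (M.left j)) +
      C ((deriv w (M.left j) + deriv w (M.right j)) / 2) * (X - C (M.left j)), by
    rw [mem_degreeLE]
    refine (degree_add_le _ _).trans (max_le (degree_C_le.trans (by norm_num)) ?_)
    rw [← smul_eq_C_mul]
    exact (degree_smul_le _ _).trans (degree_X_sub_C _).le⟩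

theorem quasiInterpolant_eval (M : DGMesh a b N) (w : ℝ → ℝ) (j : Fin N) (x : ℝ) :
    (M.quasiInterpolant w j : ℝ[X]).eval x =
      (w (M.left j) + w (M.right j)) / 2 - M.h / 2 * deriv w (M.left j)
        + (deriv w (M.left j) + deriv w (M.right j)) / 2 * (x - M.left j) := by
  simp [quasiInterpolant]

theorem derivative_quasiInterpolant_eval (M : DGMesh a b N) (w : ℝ → ℝ) (j : Fin N) (x : ℝ) :
    (derivative (M.quasiInterpolant w j : ℝ[X])).eval x =
      (deriv w (M.left j) + deriv w (M.right j)) / 2 := by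
  simp [quasiInterpolant]

theorem quasiInterpolant_sub (M : DGMesh a b N) {w₁ w₂ : ℝ → ℝ} (hw₁ : ContDiff ℝ ∞ w₁)
    (hw₂ : ContDiff ℝ ∞ w₂) :
    M.quasiInterpolant (fun x => w₁ x - w₂ x) = M.quasiInterpolant w₁ - M.quasiInterpolant w₂ := by
  have hd : deriv (fun x => w₁ x - w₂ x) = fun x => deriv w₁ x - deriv w₂ x := funext fun x =>
    ((hasDerivAt_of_contDiff hw₁ _).sub (hasDerivAt_of_contDiff hw₂ _)).deriv
  funext j
  refine Subtype.ext (Polynomial.funext fun x => ?_)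
  simp only [quasiInterpolant_eval, hd, Pi.sub_apply, Submodule.coe_sub, eval_sub]
  ring

/-- The quasi-interpolant reproduces linear functions, so its error is a combination of first-order
Taylor remainders at the left end, with total weight 1 + 1/2 + 1/2 = 2. -/
theorem l2Dist_quasiInterpolant_le {M : DGMesh a b N} (hab : a < b) (hM : M.IsUniform)
    {w : ℝ → ℝ} (hw : ContDiff ℝ ∞ w) :
    M.l2Dist w (M.quasiInterpolant w) ≤ 2 * M.h ^ 2 * l2Norm a b (iteratedDeriv 2 w) := by
  have hL := l2Norm_nonneg a b (iteratedDeriv 2 w)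
  have hh0 := M.h_nonneg
  rw [l2Dist]
  refine Real.sqrt_le_iff.2 ⟨by positivity, ?_⟩
  rw [mul_pow, ← M.sum_sq_l2Norm_cell hab.le (iteratedDeriv_contDiff hw _).continuous,
    Finset.mul_sum]
  refine Finset.sum_le_sum fun j _ => ?_
  rw [← sq_l2Norm (M.left_le_right j), ← mul_pow]
  refine pow_le_pow_left₀ (l2Norm_nonneg _ _ _) ?_ 2
  have hl : M.left j ∈ Icc (M.left j) (M.right j) := left_mem_Icc.2 (M.left_le_right j)
  have hr : M.right j ∈ Icc (M.left j) (M.right j) := right_mem_Icc.2 (M.left_le_right j)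
  have h0 := abs_sub_taylorPoly_le hl 1 hw
  have h1 := abs_deriv_sub_taylorPoly_le hl 0 hw
  have hrl : M.right j - M.left j = M.h := by rw [hM.right_eq]; ring
  rw [hrl] at h0 h1
  norm_num only at h0 h1
  set G := l2Norm (M.left j) (M.right j) (iteratedDeriv 2 w)
  have hG0 : 0 ≤ G := l2Norm_nonneg _ _ _
  have hT : ∀ x, (taylorPoly 1 w (M.left j)).eval x =
      w (M.left j) + deriv w (M.left j) * (x - M.left j) := fun x => by
    simp [taylorPoly, Finset.sum_range_succ, iteratedDeriv_one]
  have hT' : ∀ x, (derivative (taylorPoly 1 w (M.left j))).eval x = deriv w (M.left j) :=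
    fun x => by simp [taylorPoly, Finset.sum_range_succ, iteratedDeriv_one]
  simp only [hT, hT', pow_one, pow_zero, one_mul] at h0 h1
  have hs := Real.mul_self_sqrt hh0
  have hb : ∀ x ∈ Icc (M.left j) (M.right j),
      |w x - (M.quasiInterpolant w j : ℝ[X]).eval x| ≤ 2 * (M.h * √M.h * G) := by
    intro x hx
    have hxl : |(x - M.left j) - M.h| ≤ M.h := by
      rw [abs_le]; constructor <;> linarith [hx.1, hx.2]
    have e : w x - (M.quasiInterpolant w j : ℝ[X]).eval x =
        (w x - (w (M.left j) + deriv w (M.left j) * (x - M.left j)))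
        - (w (M.right j) - (w (M.left j) + deriv w (M.left j) * (M.right j - M.left j))) / 2
        - (deriv w (M.right j) - deriv w (M.left j)) * ((x - M.left j) / 2) := by
      rw [quasiInterpolant_eval, hrl]; ring
    have h2 := h0 x hx
    have h3 := h0 _ hr
    have h4 : |(deriv w (M.right j) - deriv w (M.left j)) * ((x - M.left j) / 2)| ≤
        √M.h * G * (M.h / 2) := by
      rw [abs_mul]
      refine mul_le_mul (h1 _ hr) ?_ (abs_nonneg _) (by positivity)
      rw [abs_of_nonneg (by linarith [hx.1])]
      linarith [hx.2]
    rw [e]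
    have h5 := abs_le.1 h2
    have h6 := abs_le.1 h3
    have h7 := abs_le.1 h4
    rw [abs_le]
    constructor <;> linarith
  have hwc := hw.continuous
  have := l2Norm_le_of_abs_le (M.left_le_right j)
    (f := fun x => w x - (M.quasiInterpolant w j : ℝ[X]).eval x) (by fun_prop) (by positivity) hb
  rw [hrl] at this
  refine this.trans (le_of_eq ?_)
  calc √M.h * (2 * (M.h * √M.h * G)) = 2 * M.h * (√M.h * √M.h) * G := by ring
    _ = _ := by rw [hs]; ring

variable [NeZero N]

/-- A patch is a cell together with its two periodic neighbours, so each cell is counted three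
times. -/
theorem sum_sq_l2Norm_patch {M : DGMesh a b N} (hab : a < b) (hM : M.IsUniform)
    {f : ℝ → ℝ} (hf : Continuous f) (hp : Function.Periodic f (b - a)) :
    ∑ j, l2Norm (M.left j - M.h) (M.left j + 2 * M.h) f ^ 2 = 3 * l2Norm a b f ^ 2 := by
  have hh0 := M.h_nonneg
  set I : Fin N → ℝ := fun j => ∫ x in (M.left j)..(M.right j), f x ^ 2 with hI
  have hint : ∀ c d, IntervalIntegrable (fun x => f x ^ 2) MeasureTheory.volume c d :=
    fun c d => (hf.pow 2).intervalIntegrable _ _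
  have hsp : ∀ j, l2Norm (M.left j - M.h) (M.left j + 2 * M.h) f ^ 2 =
      (∫ x in (M.left j - M.h)..(M.left j), f x ^ 2) + I j
        + ∫ x in (M.right j)..(M.right j + M.h), f x ^ 2 := by
    intro j
    rw [sq_l2Norm (by linarith), show M.left j + 2 * M.h = M.right j + M.h by
      rw [hM.right_eq]; ring, hI,
      intervalIntegral.integral_add_adjacent_intervals (hint _ _) (hint _ _),
      intervalIntegral.integral_add_adjacent_intervals (hint _ _) (hint _ _)]
  have hR : ∀ j, ∫ x in (M.right j)..(M.right j + M.h), f x ^ 2 = I (j + 1) := by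
    intro j
    have e1 := intervalIntegral.integral_comp_add_left (a := 0) (b := M.h) (fun x => f x ^ 2)
      (M.right j)
    have e2 := intervalIntegral.integral_comp_add_left (a := 0) (b := M.h) (fun x => f x ^ 2)
      (M.left (j + 1))
    simp only [M.periodic_left_add_one hp, add_zero] at e1 e2
    simp only [hI, hM.right_eq (j + 1)]
    rw [← e1, ← e2]
  have hL : ∀ j, ∫ x in (M.left (j + 1) - M.h)..(M.left (j + 1)), f x ^ 2 = I j := by
    intro j
    have e1 := intervalIntegral.integral_comp_add_left (a := -M.h) (b := 0) (fun x => f x ^ 2)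
      (M.right j)
    have e2 := intervalIntegral.integral_comp_add_left (a := -M.h) (b := 0) (fun x => f x ^ 2)
      (M.left (j + 1))
    simp only [M.periodic_left_add_one hp, add_zero, ← sub_eq_add_neg] at e1 e2
    rw [← e2, e1, hI]
    congr 1
    rw [hM.right_eq]; ring
  simp only [hsp, Finset.sum_add_distrib, hR]
  rw [← sum_add_one fun j => ∫ x in (M.left j - M.h)..(M.left j), f x ^ 2]
  simp only [hL]
  rw [sum_add_one, sq_l2Norm hab.le, ← M.sum_integral_cell (f := fun x => f x ^ 2) (hf.pow 2)]
  ring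

/-- At an interface the terms ±(h/2) w' in the two traces cancel in the average. The errors left in
value and derivative averages are a quarter of the second differences of w and w'. Summed against
the jumps of v and v_x and regrouped by cells, they enter only through the two combinations of
`cubic_difference_defect`. -/
theorem abs_A_quasiInterpolant_add_integral_le {M : DGMesh a b N} (hab : a < b)
    (hM : M.IsUniform) {w : ℝ → ℝ} (hw : ContDiff ℝ ∞ w) (hp : Function.Periodic w (b - a))
    (v : DGSpace N 1) :
    |M.A (M.quasiInterpolant w) v
        + ∑ j, ∫ x in (M.left j)..(M.right j), iteratedDeriv 2 w x * (v j : ℝ[X]).eval x| ≤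
      1080 * M.h ^ 2 * l2Norm a b (iteratedDeriv 4 w) * ‖M.ofDG v‖ := by
  have hv : ∀ j, ∃ α σ : ℝ, (∀ x, (v j : ℝ[X]).eval x = α + σ * (x - M.left j)) ∧
      (∀ x, (derivative (v j : ℝ[X])).eval x = σ) ∧ derivative (derivative (v j : ℝ[X])) = 0 := by
    intro j
    have hdeg := mem_degreeLE.1 (v j).2
    obtain ⟨c, d, hcd⟩ : ∃ c d, (v j : ℝ[X]) = C c * X + C d :=
      ⟨_, _, eq_X_add_C_of_degree_le_one (by exact_mod_cast hdeg)⟩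
    refine ⟨d + c * M.left j, c, fun x => ?_, fun x => ?_, ?_⟩ <;> rw [hcd] <;> simp
    ring
  choose α σ hv0 hv1 hv2 using hv
  have hN : 0 < M.h := by
    rw [show M.h = M.right 0 - M.left 0 by rw [hM.right_eq]; ring]
    exact M.cellSize_pos 0
  set h := M.h with hh
  set d := deriv w with hd
  have hdp : Function.Periodic d (b - a) := periodic_deriv hp
  -- `E` and `E'` are the errors at the right end of a cell, `F` and `F'` those at the left end
  set E : Fin N → ℝ := fun j => (w (M.left j) - 2 * w (M.left j + h) + w (M.left j + 2 * h)) / 4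
    with hE
  set E' : Fin N → ℝ := fun j => (d (M.left j) - 2 * d (M.left j + h) + d (M.left j + 2 * h)) / 4
    with hE'
  set F : Fin N → ℝ := fun j => (w (M.left j - h) - 2 * w (M.left j) + w (M.left j + h)) / 4
    with hF
  set F' : Fin N → ℝ := fun j => (d (M.left j - h) - 2 * d (M.left j) + d (M.left j + h)) / 4
    with hF'
  have hshift : ∀ {f : ℝ → ℝ}, Function.Periodic f (b - a) → ∀ j,
      f (M.left (j + 1)) = f (M.left j + h) ∧ f (M.left (j + 1) + h) = f (M.left j + 2 * h) ∧
      f (M.left (j + 1) - h) = f (M.left j) := by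
    intro f hf j
    refine ⟨?_, ?_, ?_⟩
    · rw [M.periodic_left_add_one' hf, hM.right_eq]
    · rw [M.periodic_left_add_one hf, hM.right_eq]; congr 1; ring
    · rw [sub_eq_add_neg, M.periodic_left_add_one hf, hM.right_eq]; congr 1; ring
  have hFE : ∀ j, F (j + 1) = E j := fun j => by
    simp only [hF, hE, (hshift hp j).1, (hshift hp j).2.1, (hshift hp j).2.2]
  have hFE' : ∀ j, F' (j + 1) = E' j := fun j => by
    simp only [hF', hE', (hshift hdp j).1, (hshift hdp j).2.1, (hshift hdp j).2.2]
  have hA : M.A (M.quasiInterpolant w) v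
        + ∑ j, ∫ x in (M.left j)..(M.right j), iteratedDeriv 2 w x * (v j : ℝ[X]).eval x =
      ∑ j, ((F' j - E' j) * ((α j + (α j + σ j * h)) / 2)
        + ((E j - F j) - h / 2 * (E' j + F' j)) * σ j) := by
    rw [M.A_add_integral hw hp]
    simp only [hv2, eval_zero, mul_zero, intervalIntegral.integral_zero, Finset.sum_const_zero,
      neg_zero, zero_add]
    -- Summation by parts: a cyclic shift changes a sum over cells, with errors at both ends, into a
    -- sum over interfaces, with traces from both sides.
    have hsum : ∑ j, ((F' j - E' j) * ((α j + (α j + σ j * h)) / 2)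
        + ((E j - F j) - h / 2 * (E' j + F' j)) * σ j) =
        ∑ j, (F' (j + 1) * α (j + 1) - F (j + 1) * σ (j + 1))
        - ∑ j, (E' j * (α j + σ j * h) - E j * σ j) := by
      rw [sum_add_one fun j => F' j * α j - F j * σ j, ← Finset.sum_sub_distrib]
      exact Finset.sum_congr rfl fun j _ => by ring
    rw [hsum, ← Finset.sum_sub_distrib]
    refine Finset.sum_congr rfl fun j _ => ?_
    simp only [avg, jump, traceMinus, tracePlus, quasiInterpolant_eval,
      derivative_quasiInterpolant_eval, hv0, hv1, hFE, hFE', hM.right_eq, (hshift hp j).1,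
      (hshift hp j).2.1, ← hd, (hshift hdp j).1, (hshift hdp j).2.1, ← hh]
    simp only [hE, hE']
    ring
  set G : Fin N → ℝ := fun j => l2Norm (M.left j - h) (M.left j + 2 * h) (iteratedDeriv 4 w)
    with hG
  set V : Fin N → ℝ := fun j => l2Norm (M.left j) (M.right j) (M.ofDG v j) with hV
  have hV0 : ∀ j, √h * (|α j| + |α j + σ j * h|) ≤ 4 * V j := by
    intro j
    have := sqrt_mul_abs_le_l2Norm_linear (l := M.left j) hN (α j) (σ j)
    rw [← hM.right_eq] at this
    simp only [← hv0] at this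
    exact this
  have hterm : ∀ j, |(F' j - E' j) * ((α j + (α j + σ j * h)) / 2)
        + ((E j - F j) - h / 2 * (E' j + F' j)) * σ j| ≤ 540 * h ^ 2 * (G j * V j) := by
    intro j
    obtain ⟨h1, h2⟩ := cubic_difference_defect hw hN (M.left j)
    rw [← hd] at h1 h2
    set κ := (3 * h) ^ 2 * √(3 * h) * l2Norm (M.left j - h) (M.left j + 2 * h) (iteratedDeriv 4 w)
      with hκ
    have hG0 : 0 ≤ G j := l2Norm_nonneg _ _ _
    have hκ' : κ ≤ 18 * h ^ 2 * √h * G j := by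
      have h3 : √(3 * h) ≤ 2 * √h := by
        rw [Real.sqrt_mul (by norm_num)]
        refine mul_le_mul_of_nonneg_right ?_ (Real.sqrt_nonneg _)
        rw [Real.sqrt_le_iff]; norm_num
      calc κ ≤ (3 * h) ^ 2 * (2 * √h) * G j := by rw [hκ]; gcongr
        _ = _ := by ring
    have hP : |F' j - E' j| ≤ 2 * κ := by
      have e : F' j - E' j = (d (M.left j - h) - 3 * d (M.left j) + 3 * d (M.left j + h)
          - d (M.left j + 2 * h)) / 4 := by simp only [hF', hE']; ring
      rw [e, abs_div, abs_of_pos (by norm_num : (0 : ℝ) < 4)]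
      linarith
    have hQ : |(E j - F j) - h / 2 * (E' j + F' j)| ≤ 13 / 2 * h * κ := by
      have e : (E j - F j) - h / 2 * (E' j + F' j) =
          ((w (M.left j + 2 * h) - 3 * w (M.left j + h) + 3 * w (M.left j) - w (M.left j - h))
          - h / 2 * (d (M.left j - h) - d (M.left j) - d (M.left j + h) + d (M.left j + 2 * h)))
            / 4 := by simp only [hF, hF', hE, hE']; ring
      rw [e, abs_div, abs_of_pos (by norm_num : (0 : ℝ) < 4)]
      linarith
    have hκ0 : 0 ≤ κ := by linarith [abs_nonneg (F' j - E' j)]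
    set S := |α j| + |α j + σ j * h| with hS
    have hS1 : |(α j + (α j + σ j * h)) / 2| ≤ S / 2 := by
      rw [abs_div, abs_two]
      have := abs_add_le (α j) (α j + σ j * h)
      linarith
    have hS2 : h * |σ j| ≤ S := by
      have e : h * |σ j| = |(α j + σ j * h) - α j| := by
        rw [add_sub_cancel_left, abs_mul, abs_of_pos hN, mul_comm]
      rw [e]
      refine (abs_sub _ _).trans ?_
      rw [hS]; linarith
    calc _ ≤ |F' j - E' j| * |(α j + (α j + σ j * h)) / 2|
          + |(E j - F j) - h / 2 * (E' j + F' j)| * |σ j| := by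
          rw [← abs_mul, ← abs_mul]; exact abs_add_le _ _
      _ ≤ 2 * κ * (S / 2) + 13 / 2 * h * κ * |σ j| := by gcongr
      _ = κ * S + 13 / 2 * κ * (h * |σ j|) := by ring
      _ ≤ κ * S + 13 / 2 * κ * S := by gcongr
      _ = 15 / 2 * κ * S := by ring
      _ ≤ 15 / 2 * (18 * h ^ 2 * √h * G j) * S := by
          have : 0 ≤ S := by positivity
          gcongr
      _ = 135 * h ^ 2 * G j * (√h * S) := by ring
      _ ≤ 135 * h ^ 2 * G j * (4 * V j) := by
          refine mul_le_mul_of_nonneg_left (hV0 j) (by positivity)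
      _ = _ := by ring
  rw [hA]
  refine (Finset.abs_sum_le_sum_abs _ _).trans ((Finset.sum_le_sum fun j _ => hterm j).trans ?_)
  rw [← Finset.mul_sum]
  have hcs := Finset.sum_mul_sq_le_sq_mul_sq Finset.univ G V
  rw [sum_sq_l2Norm_patch hab hM (iteratedDeriv_contDiff hw 4).continuous
    (periodic_iteratedDeriv hp 4), ← M.sq_norm_broken] at hcs
  have hL := l2Norm_nonneg a b (iteratedDeriv 4 w)
  -- Cauchy–Schwarz with the threefold overlap of the patches gives the factor √3, rounded up to 2.
  have h5 : ∑ j, G j * V j ≤ 2 * l2Norm a b (iteratedDeriv 4 w) * ‖M.ofDG v‖ := by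
    refine le_of_sq_le_sq (hcs.trans ?_) (by positivity)
    nlinarith [sq_nonneg (l2Norm a b (iteratedDeriv 4 w) * ‖M.ofDG v‖)]
  calc 540 * h ^ 2 * ∑ j, G j * V j ≤
        540 * h ^ 2 * (2 * l2Norm a b (iteratedDeriv 4 w) * ‖M.ofDG v‖) := by gcongr
    _ = _ := by ring

/-! ### Approximation in `V_h^k` -/

/-- Every smooth periodic function has approximations in `V_h^k`, compatible with differences, that
are accurate in `L²` and consistent with the bilinear form. -/
theorem exists_approximation {a b : ℝ} (hab : a < b) {k : ℕ} (hk : 1 ≤ k) :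
    ∃ K : ℝ, 0 ≤ K ∧ ∀ (N : ℕ) [NeZero N] (M : DGMesh a b N), (k = 1 → M.IsUniform) →
      ∃ R : (ℝ → ℝ) → DGSpace N k → Prop,
        (∀ w, ContDiff ℝ ∞ w → ∃ χ, R w χ) ∧
        (∀ w₁ w₂ χ₁ χ₂, ContDiff ℝ ∞ w₁ → ContDiff ℝ ∞ w₂ → R w₁ χ₁ → R w₂ χ₂ →
          R (fun x => w₁ x - w₂ x) (χ₁ - χ₂)) ∧
        (∀ w χ, ContDiff ℝ ∞ w → Function.Periodic w (b - a) → R w χ →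
          M.l2Dist w χ ≤ K * M.h ^ (k + 1) * l2Norm a b (iteratedDeriv (k + 1) w)) ∧
        ∀ w χ, ContDiff ℝ ∞ w → Function.Periodic w (b - a) → R w χ → ∀ v : DGSpace N k,
          |M.A χ v
            + ∑ j, ∫ x in (M.left j)..(M.right j), iteratedDeriv 2 w x * (v j : ℝ[X]).eval x| ≤
          K * M.h ^ (k + 1) * l2Norm a b (iteratedDeriv (k + 3) w) * ‖M.ofDG v‖ := by
  rcases hk.eq_or_lt with rfl | hk
  -- The consistency constant 1080 = 2 · 540 also covers the constant 2 of the `L²` estimate.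
  · refine ⟨1080, by norm_num, fun N _ M hM => ⟨fun w χ => χ = M.quasiInterpolant w,
      fun w _ => ⟨_, rfl⟩, ?_, ?_, ?_⟩⟩
    · rintro w₁ w₂ _ _ hw₁ hw₂ rfl rfl
      exact (M.quasiInterpolant_sub hw₁ hw₂).symm
    · rintro w _ hw _ rfl
      refine (l2Dist_quasiInterpolant_le hab (hM rfl) hw).trans ?_
      have := l2Norm_nonneg a b (iteratedDeriv 2 w)
      have := M.h_nonneg
      gcongr
      norm_num
    · rintro w _ hw hp rfl v
      exact abs_A_quasiInterpolant_add_integral_le hab (hM rfl) hw hp v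
  · obtain ⟨m, rfl⟩ : ∃ m, k = m + 1 := ⟨k - 1, by omega⟩
    obtain ⟨K, hK0, hK⟩ := exists_l2Dist_ellipticProjection_le m (by omega)
    refine ⟨K, hK0, fun N _ M _ => ⟨M.IsEllipticProjection, fun w hw =>
      M.exists_ellipticProjection hab hk hw.continuous, fun _ _ _ _ hw₁ hw₂ h₁ h₂ =>
      h₁.sub h₂ hw₁ hw₂, fun w χ hw hp h => hK hab M hw hp h, fun w χ hw hp h v => ?_⟩⟩
    rw [h.A_add_integral_eq_zero hk hw hp, abs_zero]
    have := M.h_nonneg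
    have := l2Norm_nonneg a b (iteratedDeriv (m + 1 + 3) w)
    positivity

end DGMesh

/-! ### Functions of space and time, smooth up to the initial and final times -/

/-- `F`, a function of `(x, t)`, is smooth for `t ∈ [0, T]`, up to the boundary. -/
def SmoothInTime (T : ℝ) (F : ℝ → ℝ → ℝ) : Prop :=
  ContDiffOn ℝ ∞ (fun p : ℝ × ℝ => F p.1 p.2) (univ ×ˢ Icc 0 T)

namespace SmoothInTime

variable {T : ℝ} {F : ℝ → ℝ → ℝ}

theorem space (hF : SmoothInTime T F) {t : ℝ} (ht : t ∈ Icc 0 T) :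
    ContDiff ℝ ∞ fun x => F x t := by
  rw [← contDiffOn_univ]
  exact ContDiffOn.comp hF (g := fun p : ℝ × ℝ => F p.1 p.2) (f := fun x : ℝ => (x, t))
    (by fun_prop) fun x _ => ⟨mem_univ _, ht⟩

theorem time (hF : SmoothInTime T F) (x : ℝ) : ContDiffOn ℝ ∞ (fun s => F x s) (Icc 0 T) :=
  ContDiffOn.comp hF (g := fun p : ℝ × ℝ => F p.1 p.2) (f := fun s : ℝ => (x, s))
    (by fun_prop) fun s hs => ⟨mem_univ _, hs⟩

theorem continuousOn (hF : SmoothInTime T F) (x : ℝ) : ContinuousOn (fun s => F x s) (Icc 0 T) :=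
  (hF.time x).continuousOn

theorem hasFDerivWithinAt (hF : SmoothInTime T F) {x t : ℝ} (ht : t ∈ Icc 0 T) :
    HasFDerivWithinAt (fun p : ℝ × ℝ => F p.1 p.2)
      (fderivWithin ℝ (fun p : ℝ × ℝ => F p.1 p.2) (univ ×ˢ Icc 0 T) (x, t))
      (univ ×ˢ Icc 0 T) (x, t) :=
  ((hF.differentiableOn (by simp)) (x, t) ⟨mem_univ _, ht⟩).hasFDerivWithinAt

/-- Directions (1, 0) and (0, 1) give the space and time derivatives. Positivity of T makes the
closed strip a set of unique differentiability. -/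
theorem contDiffOn_fderivWithin_apply (hT : 0 < T) (hF : SmoothInTime T F) (v : ℝ × ℝ) :
    ContDiffOn ℝ ∞ (fun p : ℝ × ℝ =>
      fderivWithin ℝ (fun p : ℝ × ℝ => F p.1 p.2) (univ ×ˢ Icc 0 T) p v) (univ ×ˢ Icc 0 T) :=
  (ContDiffOn.fderivWithin hF (uniqueDiffOn_univ.prod (uniqueDiffOn_Icc hT)) (by simp)).clm_apply
    contDiffOn_const

theorem deriv_space (hT : 0 < T) (hF : SmoothInTime T F) :
    SmoothInTime T fun x t => deriv (fun y => F y t) x := by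
  refine (contDiffOn_fderivWithin_apply hT hF (1, 0)).congr ?_
  rintro ⟨x, t⟩ ⟨-, ht⟩
  have h := (hF.hasFDerivWithinAt (x := x) ht).comp_hasDerivWithinAt (s := univ)
    (f := fun y : ℝ => (y, t)) x
    ((hasDerivAt_id x).prodMk (hasDerivAt_const x t)).hasDerivWithinAt
    fun y _ => ⟨mem_univ _, ht⟩
  exact (hasDerivWithinAt_univ.1 h).deriv

theorem derivWithin_time (hT : 0 < T) (hF : SmoothInTime T F) :
    SmoothInTime T fun x t => derivWithin (fun s => F x s) (Icc 0 T) t := by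
  refine (contDiffOn_fderivWithin_apply hT hF (0, 1)).congr ?_
  rintro ⟨x, t⟩ ⟨-, ht⟩
  have h := (hF.hasFDerivWithinAt (x := x) ht).comp_hasDerivWithinAt (s := Icc 0 T)
    (f := fun s : ℝ => (x, s)) t
    ((hasDerivAt_const t x).prodMk (hasDerivAt_id t)).hasDerivWithinAt
    fun s hs => ⟨mem_univ _, hs⟩
  exact h.derivWithin (uniqueDiffOn_Icc hT t ht)

theorem iteratedDeriv_space (hT : 0 < T) (hF : SmoothInTime T F) (m : ℕ) :
    SmoothInTime T fun x t => iteratedDeriv m (fun y => F y t) x := by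
  induction m with
  | zero => simpa using hF
  | succ m ih => simpa only [iteratedDeriv_succ] using ih.deriv_space hT

theorem timeDeriv_succ (i : ℕ) (F : ℝ → ℝ → ℝ) (x t : ℝ) :
    timeDeriv T (i + 1) F x t = derivWithin (fun s => timeDeriv T i F x s) (Icc 0 T) t := by
  rw [timeDeriv, iteratedDerivWithin_succ]
  rfl

theorem timeDeriv (hT : 0 < T) (hF : SmoothInTime T F) (i : ℕ) :
    SmoothInTime T (timeDeriv T i F) := by
  induction i with
  | zero => simpa [SmoothInTime, _root_.timeDeriv] using hF
  | succ i ih =>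
    have := ih.derivWithin_time hT
    simp only [← timeDeriv_succ] at this
    exact this

theorem hasDerivAt_time (hF : SmoothInTime T F) (x : ℝ) {t : ℝ} (ht : t ∈ Ioo 0 T) :
    HasDerivAt (fun s => F x s) (derivWithin (fun s => F x s) (Icc 0 T) t) t := by
  have h := ((hF.time x).differentiableOn (by simp) t (Ioo_subset_Icc_self ht))
  exact h.hasDerivWithinAt.hasDerivAt (Icc_mem_nhds ht.1 ht.2)

theorem hasDerivAt_timeDeriv (hT : 0 < T) (hF : SmoothInTime T F) (i : ℕ) (x : ℝ) {t : ℝ}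
    (ht : t ∈ Ioo 0 T) :
    HasDerivAt (fun s => _root_.timeDeriv T i F x s) (_root_.timeDeriv T (i + 1) F x t) t := by
  rw [timeDeriv_succ]
  exact (hF.timeDeriv hT i).hasDerivAt_time x ht

/-- Time is clamped to [0, T]. This makes results on integrals of globally continuous integrands
available. -/
theorem exists_continuous_extension (hT : 0 < T) (hF : SmoothInTime T F) :
    ∃ G : ℝ → ℝ → ℝ, (Continuous fun p : ℝ × ℝ => G p.1 p.2) ∧
      ∀ x, ∀ t ∈ Icc 0 T, G x t = F x t := by
  refine ⟨fun x s => F x (projIcc 0 T hT.le s), ?_, fun x t ht => by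
    simp only [projIcc_of_mem _ ht]⟩
  exact ContinuousOn.comp_continuous (g := fun p : ℝ × ℝ => F p.1 p.2)
    (f := fun p : ℝ × ℝ => (p.1, (projIcc 0 T hT.le p.2 : ℝ))) (ContDiffOn.continuousOn hF)
    (by fun_prop) fun p => ⟨mem_univ _, Subtype.coe_prop _⟩

end SmoothInTime

theorem integral_swap_of_continuous {F : ℝ → ℝ → ℝ} (hF : Continuous fun p : ℝ × ℝ => F p.1 p.2)
    (a b c d : ℝ) :
    ∫ x in a..b, ∫ s in c..d, F x s = ∫ s in c..d, ∫ x in a..b, F x s := by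
  refine MeasureTheory.intervalIntegral_intervalIntegral_swap ?_
  exact (ContinuousOn.integrableOn_compact (isCompact_uIcc.prod isCompact_uIcc)
    hF.continuousOn).mono_set (prod_mono uIoc_subset_uIcc uIoc_subset_uIcc)

theorem continuous_integral_of_continuous {F : ℝ → ℝ → ℝ}
    (hF : Continuous fun p : ℝ × ℝ => F p.1 p.2) (c d : ℝ) :
    Continuous fun x => ∫ s in c..d, F x s :=
  intervalIntegral.continuous_parametric_intervalIntegral_of_continuous' hF c d

/-- Minkowski's integral inequality in `L²`. -/
theorem l2Norm_integral_le {a b c d K B : ℝ} (hab : a ≤ b) (hcd : c ≤ d) {F : ℝ → ℝ → ℝ}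
    (hF : Continuous fun p : ℝ × ℝ => F p.1 p.2) {κ : ℝ → ℝ} (hκ : Continuous κ)
    (hK : ∀ s ∈ Icc c d, |κ s| ≤ K) (hB : ∀ s ∈ Icc c d, l2Norm a b (fun x => F x s) ≤ B) :
    l2Norm a b (fun x => ∫ s in c..d, κ s * F x s) ≤ K * (d - c) * B := by
  have hK0 : 0 ≤ K := (abs_nonneg _).trans (hK c (left_mem_Icc.2 hcd))
  have hB0 : 0 ≤ B := (l2Norm_nonneg _ _ _).trans (hB c (left_mem_Icc.2 hcd))
  have hdc : 0 ≤ d - c := sub_nonneg.2 hcd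
  have hFx : ∀ x, Continuous fun s => F x s := fun x =>
    hF.comp (Continuous.prodMk continuous_const continuous_id)
  have hFs : ∀ s, Continuous fun x => F x s := fun s =>
    hF.comp (Continuous.prodMk continuous_id continuous_const)
  have hF2 : Continuous fun p : ℝ × ℝ => F p.1 p.2 ^ 2 := hF.pow 2
  have hκ2 : ∫ s in c..d, κ s ^ 2 ≤ (d - c) * K ^ 2 := by
    rw [← sq_l2Norm hcd]
    have := l2Norm_le_of_abs_le hcd hκ hK0 hK
    have := pow_le_pow_left₀ (l2Norm_nonneg _ _ _) this 2
    rwa [mul_pow, Real.sq_sqrt hdc] at this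
  have hκF : Continuous fun x => ∫ s in c..d, κ s * F x s :=
    continuous_integral_of_continuous (F := fun x s => κ s * F x s) (by fun_prop) c d
  refine Real.sqrt_le_iff.2 ⟨by positivity, ?_⟩
  -- Cauchy–Schwarz in s for fixed x, then Fubini, then the bound B at each time.
  calc ∫ x in a..b, (∫ s in c..d, κ s * F x s) ^ 2
      ≤ ∫ x in a..b, (d - c) * K ^ 2 * ∫ s in c..d, F x s ^ 2 := by
        refine intervalIntegral.integral_mono_on hab ((hκF.pow 2).intervalIntegrable _ _)
          ((continuous_const.mul (continuous_integral_of_continuous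
            (F := fun x s => F x s ^ 2) hF2 c d)).intervalIntegrable _ _) fun x _ => ?_
        refine (sq_integral_mul_le hcd hκ (hFx x)).trans ?_
        exact mul_le_mul_of_nonneg_right hκ2
          (intervalIntegral.integral_nonneg hcd fun _ _ => sq_nonneg _)
    _ = (d - c) * K ^ 2 * ∫ s in c..d, ∫ x in a..b, F x s ^ 2 := by
        rw [intervalIntegral.integral_const_mul,
          integral_swap_of_continuous (F := fun x s => F x s ^ 2) hF2]
    _ ≤ (d - c) * K ^ 2 * ∫ s in c..d, B ^ 2 := by
        refine mul_le_mul_of_nonneg_left ?_ (by positivity)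
        refine intervalIntegral.integral_mono_on hcd (Continuous.intervalIntegrable
          (continuous_integral_of_continuous (F := fun s x => F x s ^ 2) (by fun_prop) a b) _ _)
          (by simp) fun s hs => ?_
        rw [← sq_l2Norm hab]
        exact pow_le_pow_left₀ (l2Norm_nonneg _ _ _) (hB s hs) 2
    _ = _ := by
        rw [intervalIntegral.integral_const, smul_eq_mul]; ring

theorem l2Norm_add_le {a b : ℝ} (hab : a ≤ b) {f g : ℝ → ℝ} (hf : Continuous f)
    (hg : Continuous g) : l2Norm a b (fun x => f x + g x) ≤ l2Norm a b f + l2Norm a b g := by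
  have hf0 := l2Norm_nonneg a b f
  have hg0 := l2Norm_nonneg a b g
  refine Real.sqrt_le_iff.2 ⟨by positivity, ?_⟩
  have e : ∀ x, (f x + g x) ^ 2 = f x ^ 2 + 2 * (f x * g x) + g x ^ 2 := fun x => by ring
  simp_rw [e]
  rw [intervalIntegral.integral_add, intervalIntegral.integral_add,
    intervalIntegral.integral_const_mul, ← sq_l2Norm hab, ← sq_l2Norm hab]
  · nlinarith [le_of_abs_le (abs_integral_mul_le_l2Norm hab hf hg)]
  all_goals exact Continuous.intervalIntegrable (by fun_prop) _ _

/-! ### Time integrals of smooth functions and the consistency of the θ-rule -/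

namespace SmoothInTime

variable {T : ℝ} {F : ℝ → ℝ → ℝ}

theorem l2Norm_integral_le (hT : 0 < T) (hF : SmoothInTime T F) {a b c d K B : ℝ} (hab : a ≤ b)
    (hcd : c ≤ d) (hc : 0 ≤ c) (hd : d ≤ T) {κ : ℝ → ℝ} (hκ : Continuous κ)
    (hK : ∀ s ∈ Icc c d, |κ s| ≤ K) (hB : ∀ s ∈ Icc 0 T, l2Norm a b (fun x => F x s) ≤ B) :
    l2Norm a b (fun x => ∫ s in c..d, κ s * F x s) ≤ K * (d - c) * B := by
  obtain ⟨G, hG, hGF⟩ := hF.exists_continuous_extension hT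
  have hmem : ∀ s ∈ Icc c d, s ∈ Icc 0 T := fun s hs => ⟨hc.trans hs.1, hs.2.trans hd⟩
  have e : (fun x => ∫ s in c..d, κ s * F x s) = fun x => ∫ s in c..d, κ s * G x s := by
    funext x
    refine intervalIntegral.integral_congr fun s hs => ?_
    rw [uIcc_of_le hcd] at hs
    simp only [hGF x s (hmem s hs)]
  rw [e]
  refine _root_.l2Norm_integral_le hab hcd hG hκ hK fun s hs => ?_
  simp only [fun x => hGF x s (hmem s hs)]
  exact hB s (hmem s hs)

theorem continuous_integral (hT : 0 < T) (hF : SmoothInTime T F) {c d : ℝ} (hcd : c ≤ d)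
    (hc : 0 ≤ c) (hd : d ≤ T) {κ : ℝ → ℝ} (hκ : Continuous κ) :
    Continuous fun x => ∫ s in c..d, κ s * F x s := by
  obtain ⟨G, hG, hGF⟩ := hF.exists_continuous_extension hT
  have e : (fun x => ∫ s in c..d, κ s * F x s) = fun x => ∫ s in c..d, κ s * G x s := by
    funext x
    refine intervalIntegral.integral_congr fun s hs => ?_
    rw [uIcc_of_le hcd] at hs
    simp only [hGF x s ⟨hc.trans hs.1, hs.2.trans hd⟩]
  rw [e]
  exact continuous_integral_of_continuous (F := fun x s => κ s * G x s) (by fun_prop) c d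

/-- By Fubini the time integral of F is a constant plus the primitive in x of the time integral of
F_x, and the fundamental theorem of calculus differentiates it. -/
theorem deriv_integral (hT : 0 < T) (hF : SmoothInTime T F) {c d : ℝ} (hcd : c ≤ d) (hc : 0 ≤ c)
    (hd : d ≤ T) :
    deriv (fun x => ∫ s in c..d, F x s) = fun x => ∫ s in c..d, deriv (fun y => F y s) x := by
  have hF' := hF.deriv_space hT
  obtain ⟨G, hG, hGF⟩ := hF'.exists_continuous_extension hT
  have hmem : ∀ s ∈ uIcc c d, s ∈ Icc 0 T := fun s hs => by
    rw [uIcc_of_le hcd] at hs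
    exact ⟨hc.trans hs.1, hs.2.trans hd⟩
  have hint : ∀ x, IntervalIntegrable (fun s => F x s) MeasureTheory.volume c d := fun x =>
    ((hF.continuousOn x).mono hmem).intervalIntegrable
  have key : ∀ x, ∫ s in c..d, F x s =
      (∫ s in c..d, F 0 s) + ∫ y in (0 : ℝ)..x, ∫ s in c..d, G y s := by
    intro x
    rw [integral_swap_of_continuous hG, ← sub_eq_iff_eq_add', ← intervalIntegral.integral_sub
      (hint _) (hint _)]
    refine intervalIntegral.integral_congr fun s hs => ?_
    simp only [fun y => hGF y s (hmem s hs)]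
    exact (integral_deriv_of_contDiff (hF.space (hmem s hs)) 0 x).symm
  funext x
  have hc' := continuous_integral_of_continuous hG c d
  have h1 : HasDerivAt (fun x => ∫ y in (0 : ℝ)..x, ∫ s in c..d, G y s) (∫ s in c..d, G x s) x :=
    intervalIntegral.integral_hasDerivAt_right (hc'.intervalIntegrable _ _)
      hc'.aestronglyMeasurable.stronglyMeasurableAtFilter hc'.continuousAt
  rw [show (fun x => ∫ s in c..d, F x s) = fun x => (∫ s in c..d, F 0 s)
    + ∫ y in (0 : ℝ)..x, ∫ s in c..d, G y s from funext key, (h1.const_add _).deriv]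
  exact intervalIntegral.integral_congr fun s hs => hGF x s (hmem s hs)

theorem iteratedDeriv_integral (hT : 0 < T) (hF : SmoothInTime T F) {c d : ℝ} (hcd : c ≤ d)
    (hc : 0 ≤ c) (hd : d ≤ T) (m : ℕ) :
    iteratedDeriv m (fun x => ∫ s in c..d, F x s) =
      fun x => ∫ s in c..d, iteratedDeriv m (fun y => F y s) x := by
  induction m with
  | zero => simp
  | succ m ih =>
    rw [iteratedDeriv_succ, ih, (hF.iteratedDeriv_space hT m).deriv_integral hT hcd hc hd]
    simp only [iteratedDeriv_succ]

theorem integral_timeDeriv (hT : 0 < T) (hF : SmoothInTime T F) {c d : ℝ} (hcd : c ≤ d)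
    (hc : 0 ≤ c) (hd : d ≤ T) (i : ℕ) (x : ℝ) :
    ∫ s in c..d, _root_.timeDeriv T (i + 1) F x s =
      _root_.timeDeriv T i F x d - _root_.timeDeriv T i F x c := by
  have hsub : Icc c d ⊆ Icc 0 T := Icc_subset_Icc hc hd
  refine intervalIntegral.integral_eq_sub_of_hasDerivAt_of_le hcd
    (((hF.timeDeriv hT i).continuousOn x).mono hsub)
    (fun s hs => hF.hasDerivAt_timeDeriv hT i x ⟨hc.trans_lt hs.1, hs.2.trans_le hd⟩) ?_
  rw [intervalIntegrable_iff_integrableOn_Icc_of_le hcd]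
  exact (((hF.timeDeriv hT (i + 1)).continuousOn x).mono hsub).integrableOn_Icc

/-- The error of the trapezoidal rule in Peano form. -/
theorem integral_trapezoid (hT : 0 < T) (hF : SmoothInTime T F) {c d : ℝ} (hcd : c ≤ d)
    (hc : 0 ≤ c) (hd : d ≤ T) (x : ℝ) :
    ∫ s in c..d, (s - c) * (d - s) / 2 * _root_.timeDeriv T 3 F x s =
      (d - c) / 2 * (_root_.timeDeriv T 1 F x c + _root_.timeDeriv T 1 F x d)
        - (_root_.timeDeriv T 0 F x d - _root_.timeDeriv T 0 F x c) := by
  have hsub : Icc c d ⊆ Icc 0 T := Icc_subset_Icc hc hd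
  have hcont : ∀ i, ContinuousOn (fun s => _root_.timeDeriv T i F x s) (Icc c d) := fun i =>
    ((hF.timeDeriv hT i).continuousOn x).mono hsub
  have h0 := hcont 0
  have h1 := hcont 1
  have h2 := hcont 2
  have h3 := hcont 3
  -- This antiderivative is what two integrations by parts produce. The kernel vanishes at both
  -- ends, so only the terms in F and its first time derivative survive there.
  rw [intervalIntegral.integral_eq_sub_of_hasDerivAt_of_le hcd
    (f := fun s => (s - c) * (d - s) / 2 * _root_.timeDeriv T 2 F x s
      - (c + d - 2 * s) / 2 * _root_.timeDeriv T 1 F x s - _root_.timeDeriv T 0 F x s)]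
  · ring
  · fun_prop
  · intro s hs
    have hs' : s ∈ Ioo 0 T := ⟨hc.trans_lt hs.1, hs.2.trans_le hd⟩
    have d0 := hF.hasDerivAt_timeDeriv hT 0 x hs'
    have d1 := hF.hasDerivAt_timeDeriv hT 1 x hs'
    have d2 := hF.hasDerivAt_timeDeriv hT 2 x hs'
    have p1 : HasDerivAt (fun s : ℝ => (s - c) * (d - s) / 2) ((c + d - 2 * s) / 2) s := by
      have := (((hasDerivAt_id s).sub_const c).mul ((hasDerivAt_id s).const_sub d)).div_const 2
      refine this.congr_deriv ?_
      simp; ring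
    have p2 : HasDerivAt (fun s : ℝ => (c + d - 2 * s) / 2) (-1) s := by
      have := (((hasDerivAt_id s).const_mul 2).const_sub (c + d)).div_const 2
      refine this.congr_deriv ?_
      norm_num
    refine (((p1.mul d2).sub (p2.mul d1)).sub d0).congr_deriv ?_
    norm_num
    ring
  · rw [intervalIntegrable_iff_integrableOn_Icc_of_le hcd]
    exact ContinuousOn.integrableOn_Icc (by fun_prop)

theorem timeDeriv_zero (F : ℝ → ℝ → ℝ) : _root_.timeDeriv T 0 F = F := by
  funext x t
  simp [_root_.timeDeriv]

/-- The consistency error of the `θ`-scheme. -/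
theorem l2Norm_theta_defect_le (hT : 0 < T) (hF : SmoothInTime T F) {a b c d θ B₃ B₄ : ℝ}
    (hab : a ≤ b) (hcd : c ≤ d) (hc : 0 ≤ c) (hd : d ≤ T) (hθ : 1 / 2 ≤ θ)
    (h₃ : ∀ t ∈ Icc 0 T, l2Norm a b (fun x => _root_.timeDeriv T 2 F x t) ≤ B₃)
    (h₄ : ∀ t ∈ Icc 0 T, l2Norm a b (fun x => _root_.timeDeriv T 3 F x t) ≤ B₄) :
    l2Norm a b (fun x => (d - c) * ((1 - θ) * _root_.timeDeriv T 1 F x c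
        + θ * _root_.timeDeriv T 1 F x d) - (F x d - F x c)) ≤
      (d - c) * ((θ - 1 / 2) * (d - c) * B₃ + (d - c) ^ 2 * B₄) := by
  have hdc : 0 ≤ d - c := sub_nonneg.2 hcd
  have hθ0 : 0 ≤ θ - 1 / 2 := sub_nonneg.2 hθ
  -- The rule with weight θ is the trapezoidal rule plus θ - 1/2 times the increment of the first
  -- time derivative.
  have e : (fun x => (d - c) * ((1 - θ) * _root_.timeDeriv T 1 F x c
        + θ * _root_.timeDeriv T 1 F x d) - (F x d - F x c)) =
      fun x => (∫ s in c..d, (d - c) * (θ - 1 / 2) * _root_.timeDeriv T 2 F x s)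
        + ∫ s in c..d, (s - c) * (d - s) / 2 * _root_.timeDeriv T 3 F x s := by
    funext x
    rw [hF.integral_trapezoid hT hcd hc hd, intervalIntegral.integral_const_mul,
      hF.integral_timeDeriv hT hcd hc hd 1, timeDeriv_zero]
    ring
  rw [e]
  have hκ : Continuous fun s : ℝ => (s - c) * (d - s) / 2 := by fun_prop
  refine (l2Norm_add_le hab ((hF.timeDeriv hT 2).continuous_integral hT hcd hc hd
    continuous_const) ((hF.timeDeriv hT 3).continuous_integral hT hcd hc hd hκ)).trans ?_
  have h1 := (hF.timeDeriv hT 2).l2Norm_integral_le hT hab hcd hc hd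
    (κ := fun _ => (d - c) * (θ - 1 / 2)) (K := (d - c) * (θ - 1 / 2)) continuous_const
    (fun s _ => by rw [abs_of_nonneg (mul_nonneg hdc hθ0)]) h₃
  have h2 := (hF.timeDeriv hT 3).l2Norm_integral_le hT hab hcd hc hd hκ (K := (d - c) ^ 2)
    (fun s hs => by
      have h5 : 0 ≤ s - c := sub_nonneg.2 hs.1
      have h6 : 0 ≤ d - s := sub_nonneg.2 hs.2
      rw [abs_of_nonneg (by positivity)]
      nlinarith) h₄
  refine (add_le_add h1 h2).trans (le_of_eq ?_)
  ring

/-- The increment is the time integral of the time derivative. This yields the factor Δt needed for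
the per-step projection error. -/
theorem l2Norm_iteratedDeriv_sub_le (hT : 0 < T) (hF : SmoothInTime T F) {a b c d B : ℝ}
    (hab : a ≤ b) (hcd : c ≤ d) (hc : 0 ≤ c) (hd : d ≤ T) (m : ℕ)
    (hB : ∀ t ∈ Icc 0 T, l2Norm a b (iteratedDeriv m fun x => _root_.timeDeriv T 1 F x t) ≤ B) :
    l2Norm a b (iteratedDeriv m fun x => F x d - F x c) ≤ (d - c) * B := by
  have h1 := hF.timeDeriv hT 1
  have e : (fun x => F x d - F x c) = fun x => ∫ s in c..d, _root_.timeDeriv T 1 F x s := by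
    funext x
    rw [hF.integral_timeDeriv hT hcd hc hd 0, timeDeriv_zero]
  rw [e, h1.iteratedDeriv_integral hT hcd hc hd]
  have := (h1.iteratedDeriv_space hT m).l2Norm_integral_le hT hab hcd hc hd
    (κ := fun _ => 1) (K := 1) continuous_const (by simp) hB
  simpa using this

end SmoothInTime

/-! ### Stability of the `θ`-scheme -/

/-- The pairing of e₁ - e₀ with the θ-average equals half the increment of the squared norms plus (θ
- 1/2)‖e₁ - e₀‖². The number x stands for the A-term common to both error equations. Completing the
square in the second hypothesis gives -x ≤ σ²/4. -/
theorem energy_step {H : Type*} [SeminormedAddCommGroup H] [InnerProductSpace ℝ H] {e₀ e₁ η : H}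
    {θ δ ρ σ x : ℝ} (hθ : 1 / 2 ≤ θ) (hθ' : θ ≤ 1) (hδ : 0 ≤ δ) (hρ : 0 ≤ ρ)
    (h₁ : inner ℝ (e₁ - e₀) ((1 - θ) • e₀ + θ • e₁) + δ * x ≤
      δ * ρ * ‖(1 - θ) • e₀ + θ • e₁‖)
    (h₂ : ‖η‖ ^ 2 - x ≤ σ * ‖η‖) :
    ‖e₁‖ ^ 2 ≤ ‖e₀‖ ^ 2 + δ * (σ ^ 2 / 2 + 2 * ρ * max ‖e₀‖ ‖e₁‖) := by
  have hid : inner ℝ (e₁ - e₀) ((1 - θ) • e₀ + θ • e₁) =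
      1 / 2 * (‖e₁‖ ^ 2 - ‖e₀‖ ^ 2) + (θ - 1 / 2) * ‖e₁ - e₀‖ ^ 2 := by
    rw [norm_sub_sq_real, inner_add_right, inner_smul_right, inner_smul_right, inner_sub_left,
      inner_sub_left, real_inner_self_eq_norm_sq, real_inner_self_eq_norm_sq,
      real_inner_comm e₁ e₀]
    ring
  have hmax : ‖(1 - θ) • e₀ + θ • e₁‖ ≤ max ‖e₀‖ ‖e₁‖ := by
    refine (norm_add_le _ _).trans ?_
    rw [norm_smul, norm_smul, Real.norm_of_nonneg (by linarith), Real.norm_of_nonneg (by linarith)]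
    have h3 := mul_le_mul_of_nonneg_left (le_max_left ‖e₀‖ ‖e₁‖) (by linarith : 0 ≤ 1 - θ)
    have h4 := mul_le_mul_of_nonneg_left (le_max_right ‖e₀‖ ‖e₁‖) (by linarith : 0 ≤ θ)
    linarith
  have hx : -x ≤ σ ^ 2 / 4 := by nlinarith [sq_nonneg (‖η‖ - σ / 2)]
  have h5 := mul_le_mul_of_nonneg_left hmax (mul_nonneg hδ hρ)
  have h6 := mul_le_mul_of_nonneg_left hx hδ
  have h7 : 0 ≤ (θ - 1 / 2) * ‖e₁ - e₀‖ ^ 2 := mul_nonneg (by linarith) (sq_nonneg _)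
  rw [hid] at h₁
  nlinarith

/-- Compare E² with the square of the linear bound P. If E (n + 1) exceeded the next value of P,
dividing the increment of squares by E (n + 1) + P would contradict the recursion. The summand σ
keeps P ≥ σ, so that the source σ²/2 is dominated by a multiple of P. -/
theorem le_of_energy_growth {E : ℕ → ℝ} {δ ρ σ : ℝ} (hδ : 0 < δ) (hρ : 0 ≤ ρ) (hσ : 0 ≤ σ)
    (hE : ∀ i, 0 ≤ E i) (n : ℕ)
    (h : ∀ i < n, E (i + 1) ^ 2 ≤
      E i ^ 2 + δ * (σ ^ 2 / 2 + 2 * ρ * max (E i) (E (i + 1)))) :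
    E n ≤ E 0 + σ + n * δ * (2 * ρ + σ) := by
  induction n with
  | zero => simp [hσ]
  | succ n ih =>
    have ih' := ih fun i hi => h i (hi.trans (Nat.lt_succ_self n))
    have hn := h n (Nat.lt_succ_self n)
    push_cast
    set P := E 0 + σ + n * δ * (2 * ρ + σ) with hP
    set x := E (n + 1) with hx
    have hPσ : σ ≤ P := by
      have : 0 ≤ n * δ * (2 * ρ + σ) := by positivity
      linarith [hE 0]
    have hgoal : E 0 + σ + (n + 1) * δ * (2 * ρ + σ) = P + δ * (2 * ρ + σ) := by rw [hP]; ring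
    rw [hgoal]
    by_contra! hlt
    have hstep : 0 ≤ δ * (2 * ρ + σ) := by positivity
    have hEP : E n ≤ x := by linarith
    rw [max_eq_right hEP] at hn
    have hEn := hE n
    have h1 : E n ^ 2 ≤ P ^ 2 := pow_le_pow_left₀ hEn ih' 2
    have hx0 : 0 < x := by linarith
    have h2 : δ * (2 * ρ + σ) * (x + P) < (x - P) * (x + P) :=
      mul_lt_mul_of_pos_right (by linarith) (by linarith)
    have h3 : δ * (σ ^ 2 / 2 + 2 * ρ * x) ≤ δ * (2 * ρ + σ) * (x + P) := by
      rw [mul_assoc δ]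
      refine mul_le_mul_of_nonneg_left ?_ hδ.le
      nlinarith [mul_nonneg hσ hx0.le, mul_nonneg hσ hσ, mul_nonneg hρ (hσ.trans hPσ),
        mul_nonneg hσ (sub_nonneg.2 hPσ)]
    nlinarith

/-! ### Error equations of the fully discrete scheme -/

namespace DGMesh

variable {a b : ℝ} {N k : ℕ}

/-- The difference χ - v is the `L²` projection of χ - w, and projections do not increase the norm.
-/
theorem norm_ofDG_sub_le_of_isL2Projection (M : DGMesh a b N) {w : ℝ → ℝ} (hw : Continuous w)
    {χ v : DGSpace N k} (hv : M.IsL2Projection w v) :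
    ‖M.ofDG (χ - v)‖ ≤ M.l2Dist w χ := by
  have h0 : Inner.inner ℝ (M.ofFun w hw - M.ofDG v) (M.ofDG (χ - v)) = 0 :=
    Finset.sum_eq_zero fun j _ => hv j ((χ - v) j)
  have h1 : Inner.inner ℝ (M.ofDG (χ - v)) (M.ofDG (χ - v)) =
      -Inner.inner ℝ (M.ofFun w hw - M.ofDG χ) (M.ofDG (χ - v)) := by
    have : M.ofDG (χ - v) = (M.ofFun w hw - M.ofDG v) - (M.ofFun w hw - M.ofDG χ) := by
      rw [map_sub]; abel
    nth_rewrite 1 [this]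
    rw [inner_sub_left, h0, zero_sub]
  have h2 := abs_real_inner_le_norm (M.ofFun w hw - M.ofDG χ) (M.ofDG (χ - v))
  rw [real_inner_self_eq_norm_sq] at h1
  rw [M.l2Dist_eq hw]
  by_contra! hlt
  nlinarith [(abs_le.1 h2).1, norm_nonneg (M.ofFun w hw - M.ofDG χ)]

variable [NeZero N]

theorem A_sub_left (M : DGMesh a b N) (w₁ w₂ v : DGSpace N k) :
    M.A (w₁ - w₂) v = M.A w₁ v - M.A w₂ v := by
  have h := M.A_add_left w₁ ((-1 : ℝ) • w₂) v
  rw [A_smul_left, show w₁ + (-1 : ℝ) • w₂ = w₁ - w₂ by module] at h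
  linarith

/-- One step of the energy estimate for the error of the `θ`-scheme. -/
theorem sq_norm_theta_step_le (M : DGMesh a b N) {θ δ c₁ c₂ c₃ c₄ c₅ : ℝ} (hθ : 1 / 2 ≤ θ)
    (hθ' : θ ≤ 1) (hδ : 0 < δ) {χ₀ χ₁ ζ₀ ζ₁ u₀ u₁ q₀ q₁ : DGSpace N k} {W f₀ f₁ g₀ g₁ : M.Broken}
    (hstep : ∀ φ, M.inner (δ⁻¹ • (u₁ - u₀)) φ = -M.A ((1 - θ) • q₀ + θ • q₁) φ)
    (haux₀ : ∀ ψ, M.inner q₀ ψ = M.A u₀ ψ) (haux₁ : ∀ ψ, M.inner q₁ ψ = M.A u₁ ψ)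
    (hW : ‖W - M.ofDG (χ₁ - χ₀)‖ ≤ δ * c₁)
    (hτ : ‖δ • ((1 - θ) • f₀ + θ • f₁) - W‖ ≤ δ * c₂)
    (hf₀ : ∀ v, |M.A ζ₀ v + Inner.inner ℝ f₀ (M.ofDG v)| ≤ c₃ * ‖M.ofDG v‖)
    (hf₁ : ∀ v, |M.A ζ₁ v + Inner.inner ℝ f₁ (M.ofDG v)| ≤ c₃ * ‖M.ofDG v‖)
    (hζ₀ : ‖g₀ - M.ofDG ζ₀‖ ≤ c₄) (hζ₁ : ‖g₁ - M.ofDG ζ₁‖ ≤ c₄)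
    (hg₀ : ∀ v, |M.A χ₀ v - Inner.inner ℝ g₀ (M.ofDG v)| ≤ c₅ * ‖M.ofDG v‖)
    (hg₁ : ∀ v, |M.A χ₁ v - Inner.inner ℝ g₁ (M.ofDG v)| ≤ c₅ * ‖M.ofDG v‖)
    (hc₁ : 0 ≤ c₁) (hc₂ : 0 ≤ c₂) (hc₃ : 0 ≤ c₃) :
    ‖M.ofDG (χ₁ - u₁)‖ ^ 2 ≤ ‖M.ofDG (χ₀ - u₀)‖ ^ 2 + δ * ((c₄ + c₅) ^ 2 / 2
      + 2 * (c₁ + c₂ + c₃) * max ‖M.ofDG (χ₀ - u₀)‖ ‖M.ofDG (χ₁ - u₁)‖) := by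
  have hθ0 : 0 ≤ θ := by linarith
  have hθ1 : 0 ≤ 1 - θ := by linarith
  set φ : DGSpace N k := (1 - θ) • (χ₀ - u₀) + θ • (χ₁ - u₁) with hφ
  set ψ : DGSpace N k := (1 - θ) • (ζ₀ - q₀) + θ • (ζ₁ - q₁) with hψ
  have hJφ : M.ofDG φ = (1 - θ) • M.ofDG (χ₀ - u₀) + θ • M.ofDG (χ₁ - u₁) := by
    rw [hφ, map_add, map_smul, map_smul]
  refine energy_step (η := M.ofDG ψ) (x := M.A ψ φ) hθ hθ' hδ.le (by positivity) ?_ ?_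
  · rw [← hJφ]
    have h1 := hstep φ
    rw [inner_eq, map_smul, real_inner_smul_left, A_add_left, A_smul_left, A_smul_left,
      inv_mul_eq_iff_eq_mul₀ hδ.ne'] at h1
    have h2 : Inner.inner ℝ (M.ofDG (χ₁ - χ₀)) (M.ofDG φ) =
        -Inner.inner ℝ (W - M.ofDG (χ₁ - χ₀)) (M.ofDG φ)
        - Inner.inner ℝ (δ • ((1 - θ) • f₀ + θ • f₁) - W) (M.ofDG φ)
        + δ * ((1 - θ) * Inner.inner ℝ f₀ (M.ofDG φ) + θ * Inner.inner ℝ f₁ (M.ofDG φ)) := by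
      simp only [inner_sub_left, inner_add_left, real_inner_smul_left]
      ring
    have h3 : M.ofDG (χ₁ - u₁) - M.ofDG (χ₀ - u₀) = M.ofDG (χ₁ - χ₀) - M.ofDG (u₁ - u₀) := by
      simp only [map_sub]; abel
    have h4 := (abs_real_inner_le_norm (W - M.ofDG (χ₁ - χ₀)) (M.ofDG φ)).trans
      (mul_le_mul_of_nonneg_right hW (norm_nonneg _))
    have h5 := (abs_real_inner_le_norm (δ • ((1 - θ) • f₀ + θ • f₁) - W) (M.ofDG φ)).trans
      (mul_le_mul_of_nonneg_right hτ (norm_nonneg _))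
    have h6 := mul_le_mul_of_nonneg_left (le_of_abs_le (hf₀ φ)) (mul_nonneg hδ.le hθ1)
    have h7 := mul_le_mul_of_nonneg_left (le_of_abs_le (hf₁ φ)) (mul_nonneg hδ.le hθ0)
    rw [h3, inner_sub_left, h1, h2, hψ, A_add_left, A_smul_left, A_smul_left, A_sub_left,
      A_sub_left]
    have h8 := (abs_le.1 h4).1
    have h9 := (abs_le.1 h5).1
    linarith
  · have h1 : ‖M.ofDG ψ‖ ^ 2 = (1 - θ) * (Inner.inner ℝ (M.ofDG ζ₀) (M.ofDG ψ) - M.A u₀ ψ)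
        + θ * (Inner.inner ℝ (M.ofDG ζ₁) (M.ofDG ψ) - M.A u₁ ψ) := by
      rw [← haux₀, ← haux₁, inner_eq, inner_eq, ← real_inner_self_eq_norm_sq,
        ← inner_sub_left, ← inner_sub_left, ← real_inner_smul_left, ← real_inner_smul_left,
        ← inner_add_left]
      simp only [hψ, map_add, map_smul, map_sub]
    -- Symmetry identifies the A-term of the averaged auxiliary equation with that of the evolution
    -- equation.
    rw [h1, M.A_comm ψ φ, hφ, A_add_left, A_smul_left, A_smul_left, A_sub_left, A_sub_left]
    have h2 : ∀ {χ ζ : DGSpace N k} {g : M.Broken}, ‖g - M.ofDG ζ‖ ≤ c₄ →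
        (∀ v, |M.A χ v - Inner.inner ℝ g (M.ofDG v)| ≤ c₅ * ‖M.ofDG v‖) →
        Inner.inner ℝ (M.ofDG ζ) (M.ofDG ψ) - M.A χ ψ ≤ (c₄ + c₅) * ‖M.ofDG ψ‖ := by
      intro χ ζ g hζ hg
      have h3 := (abs_real_inner_le_norm (g - M.ofDG ζ) (M.ofDG ψ)).trans
        (mul_le_mul_of_nonneg_right hζ (norm_nonneg _))
      rw [inner_sub_left] at h3
      linarith [(abs_le.1 h3).1, (abs_le.1 (hg ψ)).1]
    have h3 := mul_le_mul_of_nonneg_left (h2 hζ₀ hg₀) hθ1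
    have h4 := mul_le_mul_of_nonneg_left (h2 hζ₁ hg₁) hθ0
    linarith

end DGMesh

/-! ### The error estimate -/

theorem iteratedDeriv_iteratedDeriv (m n : ℕ) (f : ℝ → ℝ) :
    iteratedDeriv m (iteratedDeriv n f) = iteratedDeriv (m + n) f := by
  simp only [iteratedDeriv_eq_iterate, Function.iterate_add_apply]

theorem l2Norm_neg (a b : ℝ) (f : ℝ → ℝ) : l2Norm a b (fun x => -f x) = l2Norm a b f := by
  simp [l2Norm]

theorem mainTheorem2 (a b : ℝ) (hab : a < b) (k : ℕ) (hk : 1 ≤ k) (B₁ B₂ B₃ B₄ : ℝ) :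
    ∃ C : ℝ, ∀ (T : ℝ), 0 < T →
      ∀ (u₀ : ℝ → ℝ) (u : ℝ → ℝ → ℝ), IsSmoothSolution a b T u₀ u →
      (∀ t ∈ Set.Icc 0 T,
        l2Norm a b (iteratedDeriv (k + 1) (fun x => timeDeriv T 1 u x t)) ≤ B₁) →
      (∀ t ∈ Set.Icc 0 T, l2Norm a b (iteratedDeriv (k + 3) (fun x => u x t)) ≤ B₂) →
      (∀ t ∈ Set.Icc 0 T, l2Norm a b (fun x => timeDeriv T 2 u x t) ≤ B₃) →
      (∀ t ∈ Set.Icc 0 T, l2Norm a b (fun x => timeDeriv T 3 u x t) ≤ B₄) →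
      ∀ (N : ℕ) [NeZero N] (M : DGMesh a b N), (k = 1 → M.IsUniform) →
      ∀ (θ : ℝ), 1 / 2 ≤ θ → θ ≤ 1 → ∀ (Δt : ℝ), 0 < Δt →
      ∀ (uh qh : ℕ → DGSpace N k), M.IsThetaSolution θ Δt u₀ uh qh →
      ∀ (n : ℕ), n * Δt ≤ T →
        M.l2Dist (fun x => u x (n * Δt)) (uh n) ≤
          C * (1 + T) * (M.h ^ (k + 1) + (θ - 1 / 2) * Δt + Δt ^ 2) := by
  obtain ⟨K, hK0, hK⟩ := DGMesh.exists_approximation hab hk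
  -- The first term is the approximation error of u at the initial and final times. The others come
  -- from `le_of_energy_growth` with σ = 2 K H B₂, which enters once alone and once multiplied by
  -- the elapsed time.
  refine ⟨2 * K * (b - a) ^ 2 * B₂ + 4 * K * B₂ + 4 * K * B₁ + 2 * B₃ + 2 * B₄, ?_⟩
  intro T hT u₀ u hu hB₁ hB₂ hB₃ hB₄ N _ M hM θ hθ hθ' Δt hΔt uh qh hsol n hn
  obtain ⟨R, hRex, hRsub, hRdist, hRA⟩ := hK N M hM
  have hS : SmoothInTime T u := hu.smooth
  have h0T : (0 : ℝ) ∈ Icc 0 T := ⟨le_rfl, hT.le⟩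
  have hB₁0 : 0 ≤ B₁ := (l2Norm_nonneg _ _ _).trans (hB₁ 0 h0T)
  have hB₂0 : 0 ≤ B₂ := (l2Norm_nonneg _ _ _).trans (hB₂ 0 h0T)
  have hB₃0 : 0 ≤ B₃ := (l2Norm_nonneg _ _ _).trans (hB₃ 0 h0T)
  have hB₄0 : 0 ≤ B₄ := (l2Norm_nonneg _ _ _).trans (hB₄ 0 h0T)
  have hθ0 : 0 ≤ θ - 1 / 2 := sub_nonneg.2 hθ
  set H := M.h ^ (k + 1) with hH
  have hH0 : 0 ≤ H := pow_nonneg M.h_nonneg _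
  set U : ℕ → ℝ → ℝ := fun i x => u x (i * Δt) with hU
  set Q : ℕ → ℝ → ℝ := fun i x => -iteratedDeriv 2 (U i) x with hQ
  have hmem : ∀ i : ℕ, i ≤ n → (i : ℝ) * Δt ∈ Icc 0 T := fun i hi =>
    ⟨by positivity, (mul_le_mul_of_nonneg_right (Nat.cast_le.2 hi) hΔt.le).trans hn⟩
  have hUs : ∀ i ≤ n, ContDiff ℝ ∞ (U i) := fun i hi => hS.space (hmem i hi)
  have hUp : ∀ i ≤ n, Function.Periodic (U i) (b - a) := fun i hi => hu.periodic _ (hmem i hi)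
  have hQs : ∀ i ≤ n, ContDiff ℝ ∞ (Q i) := fun i hi => (iteratedDeriv_contDiff (hUs i hi) 2).neg
  have hQp : ∀ i ≤ n, Function.Periodic (Q i) (b - a) := fun i hi x =>
    congrArg Neg.neg (periodic_iteratedDeriv (hUp i hi) 2 x)
  have hQm : ∀ i m, iteratedDeriv m (Q i) = fun x => -iteratedDeriv (m + 2) (U i) x := fun i m => by
    have h : iteratedDeriv m (Q i) = -iteratedDeriv m (iteratedDeriv 2 (U i)) :=
      funext fun x => iteratedDeriv_fun_neg m (iteratedDeriv 2 (U i)) x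
    rw [h, iteratedDeriv_iteratedDeriv]
    rfl
  have hQ2 : ∀ i ≤ n, iteratedDeriv 2 (Q i) = fun x => timeDeriv T 1 u x (i * Δt) :=
    fun i hi => by
      rw [hQm]
      exact funext fun x => (hu.eqn _ (hmem i hi) x).symm
  have hUk3 : ∀ i ≤ n, l2Norm a b (iteratedDeriv (k + 3) (U i)) ≤ B₂ := fun i hi =>
    hB₂ _ (hmem i hi)
  have hUk1 : ∀ i ≤ n, l2Norm a b (iteratedDeriv (k + 1) (U i)) ≤ (b - a) ^ 2 * B₂ := by
    intro i hi
    have h1 := l2Norm_iteratedDeriv_le_succ hab (hUs i hi) (hUp i hi) k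
    have h2 := l2Norm_iteratedDeriv_le_succ hab (hUs i hi) (hUp i hi) (k + 1)
    have h3 : 0 ≤ b - a := by linarith
    calc _ ≤ _ := h1
      _ ≤ (b - a) * ((b - a) * B₂) :=
          mul_le_mul_of_nonneg_left (h2.trans (mul_le_mul_of_nonneg_left (hUk3 i hi) h3)) h3
      _ = _ := by ring
  have hQk1 : ∀ i ≤ n, l2Norm a b (iteratedDeriv (k + 1) (Q i)) ≤ B₂ := fun i hi => by
    rw [hQm, l2Norm_neg]; exact hUk3 i hi
  -- The equation gives q_xx = u_t, so k + 3 space derivatives of q are k + 1 of u_t, and no bound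
  -- on order k + 5 of u is needed.
  have hQk3 : ∀ i ≤ n, l2Norm a b (iteratedDeriv (k + 3) (Q i)) ≤ B₁ := fun i hi => by
    rw [show k + 3 = (k + 1) + 2 from rfl, ← iteratedDeriv_iteratedDeriv, hQ2 i hi]
    exact hB₁ _ (hmem i hi)
  -- Beyond time T nothing is known about u, so 0 serves as a default there.
  have hex : ∀ i, ∃ χ ζ : DGSpace N k, i ≤ n → R (U i) χ ∧ R (Q i) ζ := by
    intro i
    by_cases hi : i ≤ n
    · obtain ⟨χ, hχ⟩ := hRex _ (hUs i hi)
      obtain ⟨ζ, hζ⟩ := hRex _ (hQs i hi)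
      exact ⟨χ, ζ, fun _ => ⟨hχ, hζ⟩⟩
    · exact ⟨0, 0, fun h => absurd h hi⟩
  choose χ ζ hχζ using hex
  have hχd : ∀ i ≤ n, M.l2Dist (U i) (χ i) ≤ K * H * ((b - a) ^ 2 * B₂) := fun i hi =>
    (hRdist _ _ (hUs i hi) (hUp i hi) (hχζ i hi).1).trans
      (mul_le_mul_of_nonneg_left (hUk1 i hi) (by positivity))
  have hζd : ∀ i (hi : i ≤ n), ‖M.ofFun (Q i) (hQs i hi).continuous - M.ofDG (ζ i)‖ ≤
      K * H * B₂ := fun i hi => by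
    rw [← M.l2Dist_eq]
    exact (hRdist _ _ (hQs i hi) (hQp i hi) (hχζ i hi).2).trans
      (mul_le_mul_of_nonneg_left (hQk1 i hi) (by positivity))
  have hut : ∀ i ≤ n, Continuous fun x => timeDeriv T 1 u x (i * Δt) := fun i hi =>
    ((hS.timeDeriv hT 1).space (hmem i hi)).continuous
  have hζA : ∀ i (hi : i ≤ n) (v : DGSpace N k),
      |M.A (ζ i) v + inner ℝ (M.ofFun _ (hut i hi)) (M.ofDG v)| ≤ K * H * B₁ * ‖M.ofDG v‖ := by
    intro i hi v
    have h := hRA _ _ (hQs i hi) (hQp i hi) (hχζ i hi).2 v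
    rw [hQ2 i hi] at h
    exact h.trans (mul_le_mul_of_nonneg_right
      (mul_le_mul_of_nonneg_left (hQk3 i hi) (by positivity)) (norm_nonneg _))
  have hχA : ∀ i (hi : i ≤ n) (v : DGSpace N k),
      |M.A (χ i) v - inner ℝ (M.ofFun _ (hQs i hi).continuous) (M.ofDG v)| ≤
        K * H * B₂ * ‖M.ofDG v‖ := by
    intro i hi v
    have h := hRA _ _ (hUs i hi) (hUp i hi) (hχζ i hi).1 v
    have e : inner ℝ (M.ofFun _ (hQs i hi).continuous) (M.ofDG v) =
        -∑ j, ∫ x in (M.left j)..(M.right j),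
          iteratedDeriv 2 (U i) x * (v j : ℝ[X]).eval x := by
      rw [M.inner_broken, ← Finset.sum_neg_distrib]
      refine Finset.sum_congr rfl fun j _ => ?_
      rw [← intervalIntegral.integral_neg]
      refine intervalIntegral.integral_congr fun x _ => ?_
      simp only [M.ofFun_apply, M.ofDG_apply, hQ]
      ring
    rw [e, sub_neg_eq_add]
    exact h.trans (mul_le_mul_of_nonneg_right
      (mul_le_mul_of_nonneg_left (hUk3 i hi) (by positivity)) (norm_nonneg _))
  have hstep : ∀ i < n, ‖M.ofDG (χ (i + 1) - uh (i + 1))‖ ^ 2 ≤ ‖M.ofDG (χ i - uh i)‖ ^ 2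
      + Δt * ((K * H * B₂ + K * H * B₂) ^ 2 / 2
        + 2 * (K * H * B₁ + ((θ - 1 / 2) * Δt * B₃ + Δt ^ 2 * B₄) + K * H * B₁)
          * max ‖M.ofDG (χ i - uh i)‖ ‖M.ofDG (χ (i + 1) - uh (i + 1))‖) := by
    intro i hi
    have hi0 : i ≤ n := hi.le
    have hi1 : i + 1 ≤ n := hi
    have hm0 := hmem i hi0
    have hm1 := hmem (i + 1) hi1
    have hdt : ((i + 1 : ℕ) : ℝ) * Δt - i * Δt = Δt := by push_cast; ring
    have hle : (i : ℝ) * Δt ≤ ((i + 1 : ℕ) : ℝ) * Δt := by linarith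
    have hWs : ContDiff ℝ ∞ fun x => U (i + 1) x - U i x := (hUs _ hi1).sub (hUs _ hi0)
    have hWp : Function.Periodic (fun x => U (i + 1) x - U i x) (b - a) := fun x => by
      simp only [hUp _ hi1 x, hUp _ hi0 x]
    refine M.sq_norm_theta_step_le (W := M.ofFun _ hWs.continuous) hθ hθ' hΔt (hsol.step i)
      (hsol.aux i) (hsol.aux (i + 1)) ?_ ?_ (hζA i hi0) (hζA (i + 1) hi1) (hζd i hi0)
      (hζd (i + 1) hi1) (hχA i hi0) (hχA (i + 1) hi1) (by positivity) (by positivity)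
      (by positivity)
    · rw [← M.l2Dist_eq]
      -- Here χ (i + 1) - χ i approximates the increment of u, whose seminorm of order k + 1 is at
      -- most Δt B₁.
      refine (hRdist _ _ hWs hWp (hRsub _ _ _ _ (hUs _ hi1) (hUs _ hi0) (hχζ _ hi1).1
        (hχζ _ hi0).1)).trans ?_
      have := hS.l2Norm_iteratedDeriv_sub_le hT hab.le hle hm0.1 hm1.2 (k + 1) hB₁
      rw [hdt] at this
      refine (mul_le_mul_of_nonneg_left this (by positivity)).trans (le_of_eq ?_)
      ring
    · have h := hS.l2Norm_theta_defect_le hT hab.le hle hm0.1 hm1.2 hθ hB₃ hB₄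
      rw [hdt] at h
      have h0 := hut i hi0
      have h1 := hut (i + 1) hi1
      have hW := hWs.continuous
      have e := M.norm_ofFun (f := fun x => Δt * ((1 - θ) * timeDeriv T 1 u x (i * Δt)
        + θ * timeDeriv T 1 u x ((i + 1 : ℕ) * Δt)) - (U (i + 1) x - U i x)) (by fun_prop)
      rw [← e] at h
      exact h
  have hgrow := le_of_energy_growth (E := fun i => ‖M.ofDG (χ i - uh i)‖) hΔt (by positivity)
    (by positivity) (fun i => norm_nonneg _) n hstep
  have hU0 : U 0 = u₀ := by
    funext x
    simp only [hU, Nat.cast_zero, zero_mul]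
    exact hu.initial x
  have hinit : ‖M.ofDG (χ 0 - uh 0)‖ ≤ K * H * ((b - a) ^ 2 * B₂) := by
    have h0 := hsol.initial
    rw [← hU0] at h0
    exact (M.norm_ofDG_sub_le_of_isL2Projection (hUs 0 (Nat.zero_le n)).continuous h0).trans
      (hχd 0 (Nat.zero_le n))
  have hfin : M.l2Dist (U n) (uh n) ≤ K * H * ((b - a) ^ 2 * B₂) + ‖M.ofDG (χ n - uh n)‖ := by
    have hc := (hUs n le_rfl).continuous
    have h1 := hχd n le_rfl
    rw [M.l2Dist_eq hc] at h1 ⊢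
    have e : M.ofFun (U n) hc - M.ofDG (uh n) =
        (M.ofFun (U n) hc - M.ofDG (χ n)) + M.ofDG (χ n - uh n) := by
      rw [map_sub]; abel
    rw [e]
    exact (norm_add_le _ _).trans (by linarith)
  refine hfin.trans ?_
  set Z := 2 * (K * H * B₁ + ((θ - 1 / 2) * Δt * B₃ + Δt ^ 2 * B₄) + K * H * B₁)
    + (K * H * B₂ + K * H * B₂) with hZ
  have hZ0 : 0 ≤ Z := by positivity
  have hTZ : n * Δt * Z ≤ T * Z := mul_le_mul_of_nonneg_right hn hZ0
  set X := H + (θ - 1 / 2) * Δt + Δt ^ 2 with hX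
  have hτ0 : 0 ≤ (θ - 1 / 2) * Δt := by positivity
  have hHX : H ≤ X := by rw [hX]; linarith [sq_nonneg Δt]
  have hτX : (θ - 1 / 2) * Δt ≤ X := by rw [hX]; linarith [sq_nonneg Δt]
  have hδX : Δt ^ 2 ≤ X := by rw [hX]; linarith
  have hX0 : 0 ≤ X := hH0.trans hHX
  have hZX : Z ≤ (4 * K * B₁ + 2 * B₃ + 2 * B₄ + 2 * K * B₂) * X := by
    have h1 : K * B₁ * H ≤ K * B₁ * X := mul_le_mul_of_nonneg_left hHX (by positivity)
    have h2 : K * B₂ * H ≤ K * B₂ * X := mul_le_mul_of_nonneg_left hHX (by positivity)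
    have h3 : B₃ * ((θ - 1 / 2) * Δt) ≤ B₃ * X := mul_le_mul_of_nonneg_left hτX hB₃0
    have h4 : B₄ * Δt ^ 2 ≤ B₄ * X := mul_le_mul_of_nonneg_left hδX hB₄0
    rw [hZ]
    linarith
  have hIX : 2 * (K * H * ((b - a) ^ 2 * B₂)) + (K * H * B₂ + K * H * B₂) ≤
      (2 * K * (b - a) ^ 2 * B₂ + 2 * K * B₂) * X := by
    have : 0 ≤ 2 * K * (b - a) ^ 2 * B₂ + 2 * K * B₂ := by positivity
    refine le_trans (le_of_eq ?_) (mul_le_mul_of_nonneg_left hHX this)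
    ring
  have hTZX := mul_le_mul_of_nonneg_left hZX hT.le
  have hrest : 0 ≤ T * ((2 * K * (b - a) ^ 2 * B₂ + 2 * K * B₂) * X)
      + (4 * K * B₁ + 2 * B₃ + 2 * B₄ + 2 * K * B₂) * X := by positivity
  linarith
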